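/- Let $P$ be a hyperbolic Riemann surface of type $(g,l_h,l_p)$, i.e. of genus $g$ with $l_h$ holes and $l_p$ punctures, let $p\in P$, $n=g+l_h+l_p$ and $m\in\mathbb N$. The product $ab$ in $\pi_1(P,p)$ means the path $b$ followed by the path $a$, $[a,b]=aba^{-1}b^{-1}$, and $\pi_1^0(P,p)$ is the set of nontrivial elements of $\pi_1(P,p)$ that are represented by simple contours. An *$m$-Arf function* is a function $\sigma:\pi_1^0(P,p)\to\mathbb Z/m\mathbb Z$ such that, whenever all arguments of $\sigma$ lie in $\pi_1^0(P,p)$: (i) $\sigma(bab^{-1})=\sigma(a)$; (ii) $\sigma(a^{-1})=-\sigma(a)$; (iii) $\sigma(ab)=\sigma(a)+\sigma(b)$ if $a,b$ are represented by simple contours that intersect only in $p$, with intersection number $\langle a,b\rangle\neq0$; (iv) $\sigma(ab)=\sigma(a)+\sigma(b)-1$ if $a,b$ are represented by simple contours that intersect only in $p$ and whose ends at $p$ occur in the clockwise cyclic order: $a$ leaving, $a$ arriving, $b$ leaving, $b$ arriving (so that $\langle a,b\rangle=0$). A *standard basis* of $\pi_1(P,p)$ is a system of generators $v=\{a_i,b_i\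 (1\le i\le g),\ c_i\ (g<i\le n)\}$ with the single defining relation $\prod_{i=1}^g[a_i,b_i]\prod_{i=g+1}^n c_i=1$, represented by simple contours any two of which intersect only in $p$, such that the contour of $c_i$ encloses a hole for $g<i\le g+l_h$ and a puncture for $g+l_h<i\le n$, and such that the ends of the contours at $p$ occur in the clockwise cyclic order: for $i=1,\dots,g$ successively $a_i$ arriving, $b_i$ leaving, $a_i$ leaving, $b_i$ arriving, and then for $i=g+1,\dots,n$ successively $c_i$ arriving, $c_i$ leaving. A *Dehn twist* takes a standard basis $v$ to a standard basis $v'=\{a_i',b_i',c_i'\}$ by one of the following rules, where elements that are not mentioned do not change, and $c_i:=[a_i,b_i]$ for $i\le g$: 1. ($g\ge1$) $a_1'=a_1b_1$. 2. ($g\ge2$) $a_1'=(a_1a_2)a_1(a_1a_2)^{-1}$, $b_1'=(a_1a_2)a_1^{-1}a_2^{-1}b_1(a_1a_2)^{-1}$, $a_2'=a_1a_2a_1^{-1}$, $b_2'=b_2a_2^{-1}a_1^{-1}$. 3. ($g\ge1$, $n>g$) with $c=c_{g+1}$: $a_g'=(b_g^{-1}c)\,b_g^{-1}(b_g^{-1}c)^{-1}$,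 $b_g'=(b_g^{-1}cb_g)\,c^{-1}b_ga_gb_g^{-1}(b_g^{-1}cb_g)^{-1}$, $c_{g+1}'=b_g^{-1}cb_g$. 4. ($1\le k<g$) $a_k'=a_{k+1}$, $b_k'=b_{k+1}$, $a_{k+1}'=(c_{k+1}^{-1}c_k)a_k(c_{k+1}^{-1}c_k)^{-1}$, $b_{k+1}'=(c_{k+1}^{-1}c_k)b_k(c_{k+1}^{-1}c_k)^{-1}$. 5. ($g<k<n$) $c_k'=c_{k+1}$, $c_{k+1}'=c_{k+1}^{-1}c_kc_{k+1}$. Let $\sigma$ be an $m$-Arf function, and let a Dehn twist of one of these types map the standard basis $v$ to the standard basis $v'$. Let $\alpha_i,\beta_i,\gamma_i$ and $\alpha_i',\beta_i',\gamma_i'$ be the values of $\sigma$ on $a_i,b_i,c_i$ and on $a_i',b_i',c_i'$. Then, in $\mathbb Z/m\mathbb Z$, respectively: 1. $\alpha_1'=\alpha_1+\beta_1$. 2. $\beta_1'=\beta_1-\alpha_1-\alpha_2-1$ and $\beta_2'=\beta_2-\alpha_2-\alpha_1-1$. 3. $\alpha_g'=-\beta_g$ and $\beta_g'=\alpha_g-\gamma_{g+1}-1$.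 4. $\alpha_k'=\alpha_{k+1}$, $\beta_k'=\beta_{k+1}$, $\alpha_{k+1}'=\alpha_k$, $\beta_{k+1}'=\beta_k$. 5. $\gamma_k'=\gamma_{k+1}$, $\gamma_{k+1}'=\gamma_k$. All values that are not mentioned do not change. -/

import Mathlib

open Set
open scoped Manifold ContDiff UpperHalfPlane

noncomputable section

namespace HigherArf

/-- The commutator `[x, y] = x y x⁻¹ y⁻¹`. -/
def groupComm {G : Type*} [Group G] (x y : G) : G := x * y * x⁻¹ * y⁻¹

/-! ### Families indexed like a standard basis -/

/-- A family `a₁, …, a_g, b₁, …, b_g, c_{g+1}, …, c_{g+n}` of elements of `X`.  Indices start at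
zero here: `a i` is `a_{i+1}`, `b i` is `b_{i+1}` and `c j` is `c_{g+j+1}`. -/
@[ext]
structure Family (X : Type*) (g n : ℕ) where
  a : Fin g → X
  b : Fin g → X
  c : Fin n → X

namespace Family

variable {X Y : Type*} {g n : ℕ}

/-- Apply a function to every member of a family. -/
def map (f : X → Y) (v : Family X g n) : Family Y g n :=
  ⟨fun i => f (v.a i), fun i => f (v.b i), fun j => f (v.c j)⟩

/-- The family as a function on its index set. -/
def get (v : Family X g n) : Fin g ⊕ Fin g ⊕ Fin n → X :=
  Sum.elim v.a (Sum.elim v.b v.c)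

/-- The ordered product `∏ [aᵢ, bᵢ] · ∏ cⱼ`, where `[a, b] = a b a⁻¹ b⁻¹`. -/
def relator {G : Type*} [Group G] (v : Family G g n) : G :=
  (List.ofFn fun i => groupComm (v.a i) (v.b i)).prod * (List.ofFn v.c).prod

/-- The free generators. -/
def free (g n : ℕ) : Family (FreeGroup (Fin g ⊕ Fin g ⊕ Fin n)) g n :=
  ⟨fun i => .of (.inl i), fun i => .of (.inr (.inl i)), fun j => .of (.inr (.inr j))⟩

/-- `v` generates the group `G`, with the single defining relation `∏ [aᵢ, bᵢ] · ∏ cⱼ = 1`. -/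
def IsPresentation {G : Type*} [Group G] (v : Family G g n) : Prop :=
  Function.Surjective (FreeGroup.lift v.get) ∧
    (FreeGroup.lift v.get).ker = Subgroup.normalClosure {(free g n).relator}

end Family

/-! ### Directions around a point of the plane -/

/-- The nonzero vectors of the list `l` have pairwise distinct directions, which are met in the
order of the list when one turns once clockwise around the origin. -/
def Clockwise (l : List ℂ) : Prop :=
  ∃ θ : Fin l.length → ℝ, StrictAnti θ ∧ (∀ i j, θ i - θ j < 2 * Real.pi) ∧
    ∀ i, ∃ ρ : ℝ, 0 < ρ ∧ l.get i = ρ * Complex.exp (θ i * Complex.I)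

open Classical in
/-- The intersection index at the origin of two oriented curves, the first of which arrives along
the ray through `aIn` and leaves along the ray through `aOut`, the second of which arrives along
the ray through `bIn` and leaves along the ray through `bOut`: it is `1` if the second curve
crosses the first one from right to left, `-1` if it crosses from left to right, and `0` if the
curves do not cross. -/
def localIndex (aIn aOut bIn bOut : ℂ) : ℤ :=
  if Clockwise [aIn, bOut, aOut, bIn] then 1
  else if Clockwise [aIn, bIn, aOut, bOut] then -1
  else 0

/-! ### Simple contours -/

section Surface

variable {P : Type*} [TopologicalSpace P]

/-- A closed path at `p` without self-intersections, apart from the common end points. -/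
def IsSimpleContour {p : P} (γ : Path p p) : Prop :=
  ∀ s t : unitInterval, γ s = γ t → s = t ∨ (s = 0 ∧ t = 1) ∨ (s = 1 ∧ t = 0)

/-- The class of a contour in the fundamental group.  The product `x * y` in Mathlib's
`FundamentalGroup` is `y` followed by `x`. -/
def contourClass {p : P} (γ : Path p p) : FundamentalGroup P p :=
  FundamentalGroup.fromPath (Path.Homotopic.Quotient.mk γ)

/-- The set `π₁⁰(P, p)` of all nontrivial elements of the fundamental group that are represented
by simple contours. -/
def simpleClasses (P : Type*) [TopologicalSpace P] (p : P) : Set (FundamentalGroup P p) :=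
  {x | x ≠ 1 ∧ ∃ γ : Path p p, IsSimpleContour γ ∧ contourClass γ = x}

/-- In the chart `φ` (which sends `p` to `0`) the contour `γ` starts along the straight ray
through `out` and comes back along the straight ray through `inn`, at constant speed. -/
def HasEnds {p : P} (φ : OpenPartialHomeomorph P ℂ) (γ : Path p p) (out inn : ℂ) : Prop :=
  ∃ ε : ℝ, 0 < ε ∧ ∀ t : unitInterval, (t : ℝ) ≤ ε →
    (γ t ∈ φ.source ∧ φ (γ t) = (t : ℝ) • out) ∧
    (γ (unitInterval.symm t) ∈ φ.source ∧ φ (γ (unitInterval.symm t)) = (t : ℝ) • inn)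

variable [ChartedSpace ℂ P]

/-- A Riemann surface is hyperbolic if its universal covering is the upper half-plane, that is, if
it is the quotient of the upper half-plane by a torsion-free Fuchsian group. -/
def IsHyperbolic (P : Type*) [TopologicalSpace P] [ChartedSpace ℂ P] : Prop :=
  ∃ f : ℍ → P, IsCoveringMap f ∧ Function.Surjective f ∧ MDifferentiable 𝓘(ℂ) 𝓘(ℂ) f

/-- The elements `x` and `y` are represented by simple contours which intersect in exactly one
point, the base point `p`.  In a holomorphic chart around `p` the contours are straight near `p`;
the directions of their ends (`x` arriving, `x` leaving, `y` arriving, `y` leaving) satisfy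
`R`. -/
def MeetOnce {p : P} (x y : FundamentalGroup P p) (R : ℂ → ℂ → ℂ → ℂ → Prop) : Prop :=
  ∃ (α β : Path p p) (φ : OpenPartialHomeomorph P ℂ) (xIn xOut yIn yOut : ℂ),
    IsSimpleContour α ∧ IsSimpleContour β ∧ contourClass α = x ∧ contourClass β = y ∧
    range α ∩ range β = {p} ∧
    φ ∈ IsManifold.maximalAtlas 𝓘(ℂ) ω P ∧ HasEnds φ α xOut xIn ∧ HasEnds φ β yOut yIn ∧
    R xIn xOut yIn yOut

/-- `x` and `y` are represented by simple contours intersecting in exactly one point `p`, with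
nonzero intersection number.  As `p` is the only common point, the intersection number is the
intersection index at `p`. -/
def IsCrossingPair {p : P} (x y : FundamentalGroup P p) : Prop :=
  MeetOnce x y fun xIn xOut yIn yOut => localIndex xIn xOut yIn yOut ≠ 0

/-- `x` and `y` are represented by simple contours intersecting in exactly one point `p`, whose
ends at `p` follow each other clockwise in the order: `x` leaving, `x` arriving, `y` leaving,
`y` arriving.  In particular their intersection number is zero. -/
def IsNegativePair {p : P} (x y : FundamentalGroup P p) : Prop :=
  MeetOnce x y fun xIn xOut yIn yOut => Clockwise [xOut, xIn, yOut, yIn]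

/-- An `m`-Arf function on `π₁⁰(P, p)`. -/
structure IsArf {p : P} {m : ℕ} (σ : simpleClasses P p → ZMod m) : Prop where
  conj : ∀ x y z : simpleClasses P p,
    (z : FundamentalGroup P p) = (y : FundamentalGroup P p) * x * (y : FundamentalGroup P p)⁻¹ →
      σ z = σ x
  inv : ∀ x z : simpleClasses P p,
    (z : FundamentalGroup P p) = (x : FundamentalGroup P p)⁻¹ → σ z = -σ x
  crossing : ∀ x y z : simpleClasses P p,
    (z : FundamentalGroup P p) = (x : FundamentalGroup P p) * y →
      IsCrossingPair (x : FundamentalGroup P p) y → σ z = σ x + σ y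
  negative : ∀ x y z : simpleClasses P p,
    (z : FundamentalGroup P p) = (x : FundamentalGroup P p) * y →
      IsNegativePair (x : FundamentalGroup P p) y → σ z = σ x + σ y - 1

/-! ### Standard bases -/

/-- Some connected component of the complement of `K` has boundary `range γ` and is
biholomorphic to the round annulus `{r < |z| < 1}`. -/
def BoundsAnnulus {p : P} (K : Set P) (γ : Path p p) (r : ℝ) : Prop :=
  ∃ f : ℂ → P, MDifferentiableOn 𝓘(ℂ) 𝓘(ℂ) f {z | r < ‖z‖ ∧ ‖z‖ < 1} ∧
    InjOn f {z | r < ‖z‖ ∧ ‖z‖ < 1} ∧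
    (∃ x ∈ Kᶜ, f '' {z | r < ‖z‖ ∧ ‖z‖ < 1} = connectedComponentIn Kᶜ x) ∧
    frontier (f '' {z | r < ‖z‖ ∧ ‖z‖ < 1}) = range γ

/-- The contour `γ` of a system of contours with union `K` encloses a puncture: it cuts off a
punctured disc. -/
def EnclosesPuncture {p : P} (K : Set P) (γ : Path p p) : Prop :=
  BoundsAnnulus K γ 0

/-- The contour `γ` of a system of contours with union `K` encloses a hole: it cuts off an annulus
of finite modulus. -/
def EnclosesHole {p : P} (K : Set P) (γ : Path p p) : Prop :=
  ∃ r : ℝ, 0 < r ∧ r < 1 ∧ BoundsAnnulus K γ r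

/-- The ends of the contours of a standard basis in their clockwise order around the base point:
for each `i` the ends `aᵢ` arriving, `bᵢ` leaving, `aᵢ` leaving, `bᵢ` arriving, and then for each
`j` the ends `cⱼ` arriving, `cⱼ` leaving. -/
def basisEnds {g n : ℕ} (out inn : Family ℂ g n) : List ℂ :=
  (List.ofFn fun i => [inn.a i, out.b i, out.a i, inn.b i]).flatten ++
    (List.ofFn fun j => [inn.c j, out.c j]).flatten

/-- A standard basis of `π₁(P, p)` for a surface `P` of genus `g` with `lh` holes and `lp`
punctures. -/
def IsStandardBasis {p : P} {g lh lp : ℕ} (v : Family (simpleClasses P p) g (lh + lp)) : Prop :=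
  (v.map Subtype.val).IsPresentation ∧
  ∃ κ : Family (Path p p) g (lh + lp),
    (∀ i, IsSimpleContour (κ.get i)) ∧
    (∀ i, contourClass (κ.get i) = v.get i) ∧
    (∀ i j, i ≠ j → range (κ.get i) ∩ range (κ.get j) = {p}) ∧
    (∀ j : Fin lh, EnclosesHole (⋃ i, range (κ.get i)) (κ.c (Fin.castAdd lp j))) ∧
    (∀ j : Fin lp, EnclosesPuncture (⋃ i, range (κ.get i)) (κ.c (Fin.natAdd lh j))) ∧
    ∃ (φ : OpenPartialHomeomorph P ℂ) (out inn : Family ℂ g (lh + lp)),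
      φ ∈ IsManifold.maximalAtlas 𝓘(ℂ) ω P ∧
      (∀ i, HasEnds φ (κ.get i) (out.get i) (inn.get i)) ∧
      Clockwise (basisEnds out inn)

end Surface

/-! ### Dehn twists -/

/-- The five types of Dehn twists for families with `g` pairs `a, b` and `n` elements `c`. -/
inductive DehnTwist (g n : ℕ) : Type
  | one (hg : 0 < g)
  | two (hg : 1 < g)
  | three (hg : 0 < g) (hn : 0 < n)
  | four (k : ℕ) (hk : k + 1 < g)
  | five (k : ℕ) (hk : k + 1 < n)

namespace DehnTwist

open Function

variable {g n : ℕ}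

/-- The transformation of bases given by a Dehn twist.  Members that are not mentioned do not
change. -/
def onBasis {G : Type*} [Group G] : DehnTwist g n → Family G g n → Family G g n
  | one hg, v =>
      { v with a := update v.a ⟨0, hg⟩ (v.a ⟨0, hg⟩ * v.b ⟨0, hg⟩) }
  | two hg, v =>
      let i₁ : Fin g := ⟨0, by omega⟩
      let i₂ : Fin g := ⟨1, hg⟩
      let a₁ := v.a i₁
      let b₁ := v.b i₁
      let a₂ := v.a i₂
      let b₂ := v.b i₂
      { v with
        a := update (update v.a i₁ ((a₁ * a₂) * a₁ * (a₁ * a₂)⁻¹)) i₂ (a₁ * a₂ * a₁⁻¹)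
        b := update (update v.b i₁ ((a₁ * a₂) * a₁⁻¹ * a₂⁻¹ * b₁ * (a₁ * a₂)⁻¹)) i₂
          (b₂ * a₂⁻¹ * a₁⁻¹) }
  | three hg hn, v =>
      let i : Fin g := ⟨g - 1, by omega⟩
      let j : Fin n := ⟨0, hn⟩
      let a := v.a i
      let b := v.b i
      let c := v.c j
      { a := update v.a i ((b⁻¹ * c) * b⁻¹ * (b⁻¹ * c)⁻¹)
        b := update v.b i ((b⁻¹ * c * b) * c⁻¹ * b * a * b⁻¹ * (b⁻¹ * c * b)⁻¹)
        c := update v.c j (b⁻¹ * c * b) }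
  | four k hk, v =>
      let i : Fin g := ⟨k, by omega⟩
      let i' : Fin g := ⟨k + 1, hk⟩
      let w := (groupComm (v.a i') (v.b i'))⁻¹ * groupComm (v.a i) (v.b i)
      { v with
        a := update (update v.a i (v.a i')) i' (w * v.a i * w⁻¹)
        b := update (update v.b i (v.b i')) i' (w * v.b i * w⁻¹) }
  | five k hk, v =>
      let j : Fin n := ⟨k, by omega⟩
      let j' : Fin n := ⟨k + 1, hk⟩
      { v with c := update (update v.c j (v.c j')) j' ((v.c j')⁻¹ * v.c j * v.c j') }

/-- The transformation of the values of an Arf function that corresponds to a Dehn twist.  Values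
that are not mentioned do not change. -/
def onValues {R : Type*} [Ring R] : DehnTwist g n → Family R g n → Family R g n
  | one hg, s =>
      { s with a := update s.a ⟨0, hg⟩ (s.a ⟨0, hg⟩ + s.b ⟨0, hg⟩) }
  | two hg, s =>
      let i₁ : Fin g := ⟨0, by omega⟩
      let i₂ : Fin g := ⟨1, hg⟩
      { s with
        b := update (update s.b i₁ (s.b i₁ - s.a i₁ - s.a i₂ - 1)) i₂
          (s.b i₂ - s.a i₂ - s.a i₁ - 1) }
  | three hg hn, s =>
      let i : Fin g := ⟨g - 1, by omega⟩
      let j : Fin n := ⟨0, hn⟩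
      { s with
        a := update s.a i (-s.b i)
        b := update s.b i (s.a i - s.c j - 1) }
  | four k hk, s =>
      let i : Fin g := ⟨k, by omega⟩
      let i' : Fin g := ⟨k + 1, hk⟩
      { s with
        a := update (update s.a i (s.a i')) i' (s.a i)
        b := update (update s.b i (s.b i')) i' (s.b i) }
  | five k hk, s =>
      let j : Fin n := ⟨k, by omega⟩
      let j' : Fin n := ⟨k + 1, hk⟩
      { s with c := update (update s.c j (s.c j')) j' (s.c j) }

end DehnTwist

end HigherArf

end

/-!
For each twist, a suitable product of new basis elements, `a₁' b₁'` and `a₂' b₂'` for the second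
type and `b_g' a_g'⁻¹` for the third, is conjugate to a product of old ones, of the shape
`bᵢ aⱼ⁻¹` or `c⁻¹ (b a)`. The value of `σ` on the former follows from rule (iii) and on the latter
from rules (iii) and (iv), and comparing the two determines the value on the new `b`. The first
type is rule (iii) itself, and all other new elements are conjugates of old ones or of their
inverses.

The rules apply only to elements of `π₁⁰`. Two facts place the elements in question there. First,
`π₁⁰` is invariant under conjugation: dragging a point along a path extends to an ambient isotopy
by injective maps, which carries simple contours to simple contours. Second, if two contours meet
only at `p`, and the end along which the first arrives is followed clockwise by the end along
which the second leaves, then cutting the corner by an arc of a small circle makes the product a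
simple contour, disjoint from every contour with no end in that corner. Products of basis elements
are nontrivial because the exponent sum of the `bᵢ` is a homomorphism to `ℤ`.
-/

noncomputable section

namespace HigherArf

section Bump

variable {E : Type*} [NormedAddCommGroup E] [NormedSpace ℝ E] {z₀ u z : E} {ρ : ℝ}

/-- The map of a normed space that moves the centre `z₀` of the ball of radius `ρ` by `u` and fixes
the complement of that ball; in between, the displacement decays linearly with the distance
from `z₀`. -/
def bump (z₀ : E) (ρ : ℝ) (u z : E) : E := z + max 0 (1 - ‖z - z₀‖ / ρ) • u

lemma bump_center (z₀ : E) (ρ : ℝ) (u : E) : bump z₀ ρ u z₀ = z₀ + u := by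
  simp [bump]

lemma bump_zero (z₀ : E) (ρ : ℝ) (z : E) : bump z₀ ρ 0 z = z := by
  simp [bump]

lemma bump_of_le (hρ : 0 < ρ) (h : ρ ≤ ‖z - z₀‖) : bump z₀ ρ u z = z := by
  have hle : 1 - ‖z - z₀‖ / ρ ≤ 0 := sub_nonpos.2 ((one_le_div hρ).2 h)
  simp [bump, max_eq_left hle]

lemma bump_mem_closedBall (hρ : 0 < ρ) (hu : ‖u‖ < ρ) (hz : ‖z - z₀‖ < ρ) :
    bump z₀ ρ u z ∈ Metric.closedBall z₀ ρ := by
  have hpos : 0 ≤ 1 - ‖z - z₀‖ / ρ := sub_nonneg.2 ((div_le_one hρ).2 hz.le)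
  rw [mem_closedBall_iff_norm, bump, max_eq_right hpos, add_sub_right_comm]
  calc ‖z - z₀ + (1 - ‖z - z₀‖ / ρ) • u‖
      ≤ ‖z - z₀‖ + (1 - ‖z - z₀‖ / ρ) * ‖u‖ := by
        refine (norm_add_le _ _).trans ?_
        rw [norm_smul, Real.norm_of_nonneg hpos]
    _ ≤ ‖z - z₀‖ + (1 - ‖z - z₀‖ / ρ) * ρ := by gcongr
    _ = ρ := by field_simp; ring

-- The displacement is Lipschitz with constant `‖u‖ / ρ < 1`.
lemma bump_injective (hρ : 0 < ρ) (hu : ‖u‖ < ρ) : Function.Injective (bump z₀ ρ u) := by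
  intro z w h
  by_contra hne
  have hpos : 0 < ‖z - w‖ := norm_sub_pos_iff.2 hne
  have hdiff : z - w = (max 0 (1 - ‖w - z₀‖ / ρ) - max 0 (1 - ‖z - z₀‖ / ρ)) • u := by
    rw [sub_smul, sub_eq_sub_iff_add_eq_add, add_comm _ w]
    exact h
  have hlip : |max 0 (1 - ‖w - z₀‖ / ρ) - max 0 (1 - ‖z - z₀‖ / ρ)| ≤ ‖z - w‖ / ρ := by
    rw [max_comm, max_comm (0 : ℝ)]
    refine (abs_max_sub_max_le_abs _ _ _).trans ?_
    rw [sub_sub_sub_cancel_left, ← sub_div, abs_div, abs_of_pos hρ]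
    gcongr
    simpa using abs_norm_sub_norm_le (z - z₀) (w - z₀)
  have : ‖z - w‖ < ‖z - w‖ :=
    calc ‖z - w‖ = |max 0 (1 - ‖w - z₀‖ / ρ) - max 0 (1 - ‖z - z₀‖ / ρ)| * ‖u‖ := by
          conv_lhs => rw [hdiff, norm_smul, Real.norm_eq_abs]
      _ ≤ ‖z - w‖ / ρ * ‖u‖ := by gcongr
      _ < ‖z - w‖ / ρ * ρ := by gcongr
      _ = ‖z - w‖ := div_mul_cancel₀ _ hρ.ne'
  exact this.false

lemma continuous_bump (z₀ : E) (ρ : ℝ) : Continuous fun q : E × E => bump z₀ ρ q.1 q.2 := by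
  unfold bump
  fun_prop

end Bump

section Push

variable {E : Type*} [NormedAddCommGroup E] [NormedSpace ℝ E] {P : Type*} [TopologicalSpace P]
  {φ : OpenPartialHomeomorph P E} {z₀ u z : E} {ρ : ℝ} {x y : P}

open Classical in
/-- The self-map of `P` that is `bump` in the chart `φ` and the identity elsewhere. -/
def push (φ : OpenPartialHomeomorph P E) (z₀ : E) (ρ : ℝ) (u : E) (x : P) : P :=
  if x ∈ φ.source then φ.symm (bump z₀ ρ u (φ x)) else x

lemma push_of_mem_source (hx : x ∈ φ.source) : push φ z₀ ρ u x = φ.symm (bump z₀ ρ u (φ x)) :=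
  if_pos hx

lemma push_of_notMem_source (hx : x ∉ φ.source) : push φ z₀ ρ u x = x :=
  if_neg hx

lemma push_of_notMem_image (hρ : 0 < ρ) (hx : x ∉ φ.symm '' Metric.closedBall z₀ ρ) :
    push φ z₀ ρ u x = x := by
  by_cases hs : x ∈ φ.source
  · rw [push_of_mem_source hs, bump_of_le hρ, φ.left_inv hs]
    by_contra! hlt
    exact hx ⟨φ x, mem_closedBall_iff_norm.2 hlt.le, φ.left_inv hs⟩
  · exact push_of_notMem_source hs

lemma push_zero (φ : OpenPartialHomeomorph P E) (z₀ : E) (ρ : ℝ) (x : P) :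
    push φ z₀ ρ 0 x = x := by
  by_cases hs : x ∈ φ.source
  · rw [push_of_mem_source hs, bump_zero, φ.left_inv hs]
  · exact push_of_notMem_source hs

lemma bump_mem_target (hρ : 0 < ρ) (hφ : Metric.closedBall z₀ ρ ⊆ φ.target) (hu : ‖u‖ < ρ)
    (hz : z ∈ φ.target) : bump z₀ ρ u z ∈ φ.target := by
  rcases lt_or_ge ‖z - z₀‖ ρ with h | h
  · exact hφ (bump_mem_closedBall hρ hu h)
  · rwa [bump_of_le hρ h]

lemma push_injective (hρ : 0 < ρ) (hφ : Metric.closedBall z₀ ρ ⊆ φ.target) (hu : ‖u‖ < ρ) :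
    Function.Injective (push φ z₀ ρ u) := by
  have htarget {x} (hx : x ∈ φ.source) : bump z₀ ρ u (φ x) ∈ φ.target :=
    bump_mem_target hρ hφ hu (φ.map_source hx)
  have hsource {x} (hx : x ∈ φ.source) : push φ z₀ ρ u x ∈ φ.source := by
    rw [push_of_mem_source hx]
    exact φ.map_target (htarget hx)
  intro x y h
  by_cases hx : x ∈ φ.source <;> by_cases hy : y ∈ φ.source
  · rw [push_of_mem_source hx, push_of_mem_source hy] at h
    exact φ.injOn hx hy (bump_injective hρ hu (φ.symm.injOn (htarget hx) (htarget hy) h))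
  · exact absurd (push_of_notMem_source hy ▸ h ▸ hsource hx) hy
  · exact absurd (push_of_notMem_source hx ▸ h.symm ▸ hsource hy) hx
  · rwa [push_of_notMem_source hx, push_of_notMem_source hy] at h

variable [ProperSpace E] [T2Space P]

lemma continuous_push (hρ : 0 < ρ) (hφ : Metric.closedBall z₀ ρ ⊆ φ.target) (hu : ‖u‖ < ρ) :
    Continuous fun q : unitInterval × P => push φ z₀ ρ ((q.1 : ℝ) • u) q.2 := by
  have hu' (t : unitInterval) : ‖(t : ℝ) • u‖ < ρ := by
    rw [norm_smul, Real.norm_of_nonneg t.2.1]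
    exact (mul_le_of_le_one_left (norm_nonneg _) t.2.2).trans_lt hu
  have hclosed : IsClosed (φ.symm '' Metric.closedBall z₀ ρ) :=
    ((isCompact_closedBall z₀ ρ).image_of_continuousOn (φ.continuousOn_symm.mono hφ)).isClosed
  rw [continuous_iff_continuousAt]
  rintro ⟨t, x⟩
  by_cases hx : x ∈ φ.source
  · have hchart : ContinuousOn (fun q : unitInterval × P => φ q.2) (Prod.snd ⁻¹' φ.source) :=
      φ.continuousOn.comp continuousOn_snd fun _ hq => hq
    have hbump : ContinuousOn (fun q : unitInterval × P => bump z₀ ρ ((q.1 : ℝ) • u) (φ q.2))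
        (Prod.snd ⁻¹' φ.source) :=
      (continuous_bump z₀ ρ).comp_continuousOn
        (ContinuousOn.prodMk (by fun_prop : Continuous _).continuousOn hchart)
    have hpush := φ.continuousOn_symm.comp hbump fun q hq =>
      bump_mem_target hρ hφ (hu' q.1) (φ.map_source hq)
    exact (hpush.congr fun q hq => push_of_mem_source hq).continuousAt
      ((φ.open_source.preimage continuous_snd).mem_nhds hx)
  · have hxK : x ∉ φ.symm '' Metric.closedBall z₀ ρ := by
      rintro ⟨z, hz, rfl⟩
      exact hx (φ.map_target (hφ hz))
    have hid : EqOn (fun q : unitInterval × P => push φ z₀ ρ ((q.1 : ℝ) • u) q.2) Prod.snd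
        (Prod.snd ⁻¹' (φ.symm '' Metric.closedBall z₀ ρ)ᶜ) :=
      fun q hq => push_of_notMem_image hρ hq
    exact (continuousOn_snd.congr hid).continuousAt
      ((hclosed.isOpen_compl.preimage continuous_snd).mem_nhds hxK)

/-- The isotopy from the identity to a push, in which the displacement grows linearly with time. -/
def pushHomotopy (hρ : 0 < ρ) (hφ : Metric.closedBall z₀ ρ ⊆ φ.target) (hu : ‖u‖ < ρ) :
    ContinuousMap.Homotopy (ContinuousMap.id P)
      ⟨push φ z₀ ρ u, by
        simpa [Function.comp_def] using
          (continuous_push hρ hφ hu).comp (Continuous.prodMk_right (1 : unitInterval))⟩ where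
  toFun q := push φ z₀ ρ ((q.1 : ℝ) • u) q.2
  continuous_toFun := continuous_push hρ hφ hu
  map_zero_left x := by simp [push_zero]
  map_one_left x := by simp

lemma pushHomotopy_evalAt_apply (hρ : 0 < ρ) (hφ : Metric.closedBall (φ y) ρ ⊆ φ.target)
    (hu : ‖u‖ < ρ) (hy : y ∈ φ.source) (t : unitInterval) :
    (pushHomotopy hρ hφ hu).evalAt y t = φ.symm (φ y + (t : ℝ) • u) := by
  change push φ (φ y) ρ ((t : ℝ) • u) y = _
  rw [push_of_mem_source hy, bump_center]

end Push

section TransportsSimple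

variable {P : Type*} [TopologicalSpace P] {x y z : P}

/-- Conjugation by `q`, a homotopy class of paths from `x` to `y`, carries classes of simple
contours at `y` to classes of simple contours at `x`. -/
def TransportsSimple (q : Path.Homotopic.Quotient x y) : Prop :=
  ∀ α : Path y y, IsSimpleContour α → ∃ β : Path x x, IsSimpleContour β ∧
    Path.Homotopic.Quotient.mk β = q.trans ((Path.Homotopic.Quotient.mk α).trans q.symm)

lemma quotient_trans_symm (q : Path.Homotopic.Quotient x y) (r : Path.Homotopic.Quotient y z) :
    (q.trans r).symm = r.symm.trans q.symm := by
  induction q using Path.Homotopic.Quotient.ind with | _ q =>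
  induction r using Path.Homotopic.Quotient.ind with | _ r =>
  simp only [← Path.Homotopic.Quotient.mk_symm, ← Path.Homotopic.Quotient.mk_trans,
    Path.trans_symm]

lemma TransportsSimple.trans {q : Path.Homotopic.Quotient x y} {r : Path.Homotopic.Quotient y z}
    (hq : TransportsSimple q) (hr : TransportsSimple r) : TransportsSimple (q.trans r) := by
  intro α hα
  obtain ⟨β, hβ, hβα⟩ := hr α hα
  obtain ⟨γ, hγ, hγβ⟩ := hq β hβ
  refine ⟨γ, hγ, ?_⟩
  rw [hγβ, hβα, quotient_trans_symm]
  simp only [Path.Homotopic.Quotient.trans_assoc]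

lemma IsSimpleContour.map {Q : Type*} [TopologicalSpace Q] {α : Path x x} (hα : IsSimpleContour α)
    {f : P → Q} (hf : Continuous f) (hinj : Function.Injective f) : IsSimpleContour (α.map hf) :=
  fun s t h => hα s t (hinj h)

lemma transportsSimple_of_homotopy {f : C(P, P)}
    (H : ContinuousMap.Homotopy (ContinuousMap.id P) f) (hf : Function.Injective f)
    (hxy : f y = x) {γ : Path x y} (hγ : (H.evalAt y).Homotopic (γ.symm.cast rfl hxy)) :
    TransportsSimple (Path.Homotopic.Quotient.mk γ) := by
  subst hxy
  intro α hα
  refine ⟨α.map f.continuous, hα.map _ hf, ?_⟩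
  have hcomm : (Path.Homotopic.Quotient.mk α).trans (Path.Homotopic.Quotient.mk γ).symm =
      (Path.Homotopic.Quotient.mk γ).symm.trans
        (Path.Homotopic.Quotient.mk (α.map f.continuous)) := by
    have hmap := Path.Homotopic.Quotient.eq.2 (Path.Homotopic.map_trans_evalAt H α)
    rwa [Path.Homotopic.Quotient.mk_trans, Path.Homotopic.Quotient.mk_trans,
      Path.Homotopic.Quotient.eq.2 hγ] at hmap
  rw [hcomm, ← Path.Homotopic.Quotient.trans_assoc, Path.Homotopic.Quotient.trans_symm,
    Path.Homotopic.Quotient.refl_trans]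

variable {E : Type*} [NormedAddCommGroup E] [NormedSpace ℝ E]

lemma homotopic_of_mem_convex (φ : OpenPartialHomeomorph P E) {C : Set E} (hC : Convex ℝ C)
    (hCφ : C ⊆ φ.target) (γ δ : Path x y) (hγ : ∀ t, γ t ∈ φ.source ∧ φ (γ t) ∈ C)
    (hδ : ∀ t, δ t ∈ φ.source ∧ φ (δ t) ∈ C) : γ.Homotopic δ := by
  have hγc : Continuous fun t => φ (γ t) :=
    φ.continuousOn.comp_continuous γ.continuous fun t => (hγ t).1
  have hδc : Continuous fun t => φ (δ t) :=
    φ.continuousOn.comp_continuous δ.continuous fun t => (hδ t).1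
  have hγl (t) : φ.symm (φ (γ t)) = γ t := φ.left_inv (hγ t).1
  have hδl (t) : φ.symm (φ (δ t)) = δ t := φ.left_inv (hδ t).1
  have hmem (q : unitInterval × unitInterval) :
      AffineMap.lineMap (φ (γ q.2)) (φ (δ q.2)) (q.1 : ℝ) ∈ C :=
    hC.lineMap_mem (hγ _).2 (hδ _).2 q.1.2
  refine ⟨{ toFun := fun q => φ.symm (AffineMap.lineMap (φ (γ q.2)) (φ (δ q.2)) (q.1 : ℝ))
            continuous_toFun := φ.continuousOn_symm.comp_continuous
              ((hγc.comp continuous_snd).lineMap (hδc.comp continuous_snd) (by fun_prop))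
              fun q => hCφ (hmem q)
            map_zero_left := fun t => by simp [hγl]
            map_one_left := fun t => by simp [hδl]
            prop' := ?_ }⟩
  rintro s t (rfl | rfl)
  · simpa using hγl 0
  · simpa using hγl 1

variable [ProperSpace E] [T2Space P]

lemma transportsSimple_of_mem_ball {φ : OpenPartialHomeomorph P E} {z₀ : E} {r : ℝ}
    (hφ : Metric.ball z₀ (3 * r) ⊆ φ.target) {γ : Path x y}
    (hγ : ∀ t, γ t ∈ φ.source ∧ φ (γ t) ∈ Metric.ball z₀ r) :
    TransportsSimple (Path.Homotopic.Quotient.mk γ) := by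
  obtain ⟨hx, hxr⟩ : x ∈ φ.source ∧ φ x ∈ Metric.ball z₀ r := by simpa using hγ 0
  obtain ⟨hy, hyr⟩ : y ∈ φ.source ∧ φ y ∈ Metric.ball z₀ r := by simpa using hγ 1
  have hr : 0 < r := Metric.pos_of_mem_ball hxr
  have hu : ‖φ x - φ y‖ < 2 * r := by
    rw [← dist_eq_norm]
    linarith [dist_triangle_right (φ x) (φ y) z₀, Metric.mem_ball.1 hxr, Metric.mem_ball.1 hyr]
  have hclosedBall : Metric.closedBall (φ y) (2 * r) ⊆ φ.target :=
    (Metric.closedBall_subset_ball' (by linarith [Metric.mem_ball.1 hyr])).trans hφ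
  have hρ : 0 < 2 * r := by positivity
  refine transportsSimple_of_homotopy (pushHomotopy hρ hclosedBall hu)
    (push_injective hρ hclosedBall hu) ?_ ?_
  · change push φ (φ y) (2 * r) (φ x - φ y) y = x
    rw [push_of_mem_source hy, bump_center, add_sub_cancel, φ.left_inv hx]
  · have hballs : Metric.ball z₀ r ⊆ φ.target :=
      (Metric.ball_subset_ball (by linarith)).trans hφ
    refine homotopic_of_mem_convex φ (convex_ball z₀ r) hballs _ _ (fun t => ?_) fun t => hγ _
    have hmem : φ y + (t : ℝ) • (φ x - φ y) ∈ Metric.ball z₀ r :=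
      (convex_ball z₀ r).add_smul_sub_mem hyr hxr t.2
    rw [pushHomotopy_evalAt_apply hρ hclosedBall hu hy, φ.right_inv (hballs hmem)]
    exact ⟨φ.map_target (hballs hmem), hmem⟩

end TransportsSimple

section ChartedSpace

variable {P : Type*} [TopologicalSpace P] [T2Space P]

lemma exists_isOpen_transportsSimple (E : Type*) [NormedAddCommGroup E] [NormedSpace ℝ E]
    [ProperSpace E] [ChartedSpace E P] (x₀ : P) :
    ∃ U : Set P, IsOpen U ∧ x₀ ∈ U ∧ ∀ {x y : P} (γ : Path x y), (∀ t, γ t ∈ U) →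
      TransportsSimple (Path.Homotopic.Quotient.mk γ) := by
  set φ := chartAt E x₀
  have hx₀ : x₀ ∈ φ.source := mem_chart_source E x₀
  obtain ⟨R, hR, hRφ⟩ := Metric.isOpen_iff.1 φ.open_target (φ x₀) (φ.map_source hx₀)
  refine ⟨φ.source ∩ φ ⁻¹' Metric.ball (φ x₀) (R / 3),
    φ.isOpen_inter_preimage Metric.isOpen_ball, ⟨hx₀, Metric.mem_ball_self (by positivity)⟩, ?_⟩
  intro x y γ hγ
  exact transportsSimple_of_mem_ball (by rwa [mul_div_cancel₀ R three_ne_zero]) hγ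

lemma transportsSimple (E : Type*) [NormedAddCommGroup E] [NormedSpace ℝ E]
    [ProperSpace E] [ChartedSpace E P] {x y : P}
    (q : Path.Homotopic.Quotient x y) : TransportsSimple q := by
  induction q using Path.Homotopic.Quotient.ind with | _ γ =>
  choose U hUo hU hUt using exists_isOpen_transportsSimple (P := P) E
  obtain ⟨t, ht0, hmono, ⟨n, hn⟩, ht⟩ := exists_monotone_Icc_subset_open_cover_unitInterval
    (c := fun x => γ ⁻¹' U x) (fun x => (hUo x).preimage γ.continuous)
    fun s _ => mem_iUnion.2 ⟨γ s, hU _⟩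
  have hinit (k : ℕ) : TransportsSimple (Path.Homotopic.Quotient.mk (γ.subpath 0 (t k))) := by
    induction k with
    | zero =>
      rw [ht0]
      refine hUt (γ 0) _ fun s => ?_
      rw [Path.subpath_self]
      exact hU _
    | succ k ih =>
      obtain ⟨i, hi⟩ := ht k
      have hstep : TransportsSimple
          (Path.Homotopic.Quotient.mk (γ.subpath (t k) (t (k + 1)))) := by
        have hle := hmono k.le_succ
        exact hUt i _ fun s => hi ⟨Icc.le_convexComb hle s, Icc.convexComb_le hle s⟩
      have h := ih.trans hstep
      rwa [← Path.Homotopic.Quotient.mk_trans, Path.Homotopic.Quotient.eq.2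
        ⟨Path.Homotopy.subpathTransSubpath γ 0 (t k) (t (k + 1))⟩] at h
  have hcast {x' y' : P} (hx : x' = x) (hy : y' = y)
      (h : TransportsSimple (Path.Homotopic.Quotient.mk (γ.cast hx hy))) :
      TransportsSimple (Path.Homotopic.Quotient.mk γ) := by
    subst hx hy
    exact h
  have htotal := hinit n
  rw [hn n le_rfl, Path.subpath_zero_one] at htotal
  exact hcast _ _ htotal

lemma mul_mul_inv_mem_simpleClasses (E : Type*) [NormedAddCommGroup E] [NormedSpace ℝ E]
    [ProperSpace E] [ChartedSpace E P] {p : P}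
    {x : FundamentalGroup P p} (hx : x ∈ simpleClasses P p) (y : FundamentalGroup P p) :
    y * x * y⁻¹ ∈ simpleClasses P p := by
  obtain ⟨hx1, α, hα, rfl⟩ := hx
  refine ⟨fun h => hx1 (conj_eq_one_iff.1 h), ?_⟩
  obtain ⟨β, hβ, hβα⟩ := transportsSimple E (y⁻¹ : FundamentalGroup P p) α hα
  have hclass : contourClass β = y⁻¹⁻¹ * contourClass α * y⁻¹ := hβα
  rw [inv_inv] at hclass
  exact ⟨β, hβ, hclass⟩

end ChartedSpace

section Directions

/-- The nonzero vector `z` has argument `θ`, which is determined only modulo `2π`. -/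
def HasArg (z : ℂ) (θ : ℝ) : Prop := ∃ ρ : ℝ, 0 < ρ ∧ z = ρ * Complex.exp (θ * Complex.I)

variable {z w : ℂ} {θ θ' c r : ℝ} {l l' : List ℂ}

lemma hasArg_circleMap (hr : 0 < r) (θ : ℝ) : HasArg (circleMap 0 r θ) θ :=
  ⟨r, hr, circleMap_zero r θ⟩

lemma HasArg.eq_circleMap (h : HasArg z θ) : z = circleMap 0 ‖z‖ θ := by
  obtain ⟨ρ, hρ, rfl⟩ := h
  rw [← circleMap_zero, norm_circleMap_zero, abs_of_pos hρ]

lemma HasArg.ne_zero (h : HasArg z θ) : z ≠ 0 := by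
  obtain ⟨ρ, hρ, rfl⟩ := h
  rw [← circleMap_zero]
  exact circleMap_ne_center hρ.ne'

lemma HasArg.smul (h : HasArg z θ) (hc : 0 < c) : HasArg (c • z) θ := by
  obtain ⟨ρ, hρ, rfl⟩ := h
  exact ⟨c * ρ, by positivity, by simp [mul_assoc]⟩

lemma HasArg.of_smul (hc : 0 ≤ c) (h : HasArg (c • z) θ) : HasArg z θ := by
  have hc0 : c ≠ 0 := fun h0 => h.ne_zero (by rw [h0, zero_smul])
  rw [← inv_smul_smul₀ hc0 z]
  exact h.smul (inv_pos.2 (hc.lt_of_ne' hc0))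

lemma HasArg.div_norm_smul (h : HasArg z θ) (r : ℝ) : (r / ‖z‖) • z = circleMap 0 r θ := by
  have hz : (‖z‖ : ℂ) ≠ 0 := by simpa using h.ne_zero
  conv_lhs => rw [h.eq_circleMap]
  rw [norm_circleMap_zero, abs_norm, circleMap_zero, circleMap_zero, Complex.real_smul]
  push_cast
  field_simp

lemma HasArg.add_two_pi (h : HasArg z θ) : HasArg z (θ + 2 * Real.pi) := by
  obtain ⟨ρ, hρ, rfl⟩ := h
  refine ⟨ρ, hρ, ?_⟩
  push_cast
  rw [add_mul, Complex.exp_periodic]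

lemma HasArg.unique (h : HasArg z θ) (h' : HasArg z θ') (hlt : |θ - θ'| < 2 * Real.pi) :
    θ = θ' :=
  eq_of_circleMap_eq (norm_ne_zero_iff.2 h.ne_zero) hlt (h.eq_circleMap.symm.trans h'.eq_circleMap)

lemma clockwise_iff_exists_list : Clockwise l ↔ ∃ L : List ℝ,
    L.Pairwise (fun θ θ' => θ' < θ ∧ θ - θ' < 2 * Real.pi) ∧ List.Forall₂ HasArg l L := by
  constructor
  · rintro ⟨θ, hθ, hlt, h⟩
    refine ⟨List.ofFn θ, List.pairwise_ofFn.2 fun i j hij => ⟨hθ hij, hlt i j⟩, ?_⟩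
    rw [List.forall₂_iff_get]
    refine ⟨by simp, fun i h₁ h₂ => ?_⟩
    simpa [HasArg] using h ⟨i, h₁⟩
  · rintro ⟨L, hL, h⟩
    obtain ⟨hlen, h⟩ := List.forall₂_iff_get.1 h
    rw [List.pairwise_iff_get] at hL
    refine ⟨fun i => L.get (i.cast hlen), fun i j hij => (hL _ _ (by simpa using hij)).1,
      fun i j => ?_, fun i => h i i.2 (by omega)⟩
    rcases lt_trichotomy i j with hij | rfl | hij
    · exact (hL _ _ (by simpa using hij)).2
    · simpa using Real.pi_pos
    · have := (hL (j.cast hlen) (i.cast hlen) (by simpa using hij)).1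
      linarith [Real.pi_pos]

lemma Clockwise.sublist (h : Clockwise l) (hl : l'.Sublist l) : Clockwise l' := by
  obtain ⟨θ, hanti, hlt, harg⟩ := h
  obtain ⟨f, hf⟩ := List.sublist_iff_exists_fin_orderEmbedding_get_eq.1 hl
  exact ⟨θ ∘ f, hanti.comp_strictMono f.strictMono, fun i j => hlt (f i) (f j),
    fun i => hf i ▸ harg (f i)⟩

lemma Clockwise.rotate (h : Clockwise (l ++ [z])) : Clockwise (z :: l) := by
  rw [clockwise_iff_exists_list] at h ⊢
  obtain ⟨L, hL, h⟩ := h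
  obtain ⟨L', θ, rfl⟩ : ∃ L' θ, L = L' ++ [θ] :=
    (List.eq_nil_or_concat' L).resolve_left (by rintro rfl; simpa using h.length_eq)
  rw [← List.forall₂_reverse_iff, List.reverse_concat, List.reverse_concat, List.forall₂_cons,
    List.forall₂_reverse_iff] at h
  obtain ⟨hL', -, hlast⟩ := List.pairwise_append.1 hL
  refine ⟨(θ + 2 * Real.pi) :: L', List.pairwise_cons.2 ⟨fun θ' hθ' => ?_, hL'⟩,
    .cons h.1.add_two_pi h.2⟩
  obtain ⟨hlt, hlt'⟩ := hlast θ' hθ' θ (List.mem_singleton_self θ)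
  constructor <;> linarith

lemma Clockwise.of_forall₂_smul (h : Clockwise l)
    (hl : List.Forall₂ (fun z w => ∃ c : ℝ, 0 < c ∧ w = c • z) l l') : Clockwise l' := by
  rw [clockwise_iff_exists_list] at h ⊢
  obtain ⟨L, hL, h⟩ := h
  refine ⟨L, hL, ?_⟩
  clear hL
  induction hl generalizing L with
  | nil => exact h
  | cons hzw _ ih =>
    obtain ⟨c, hc, rfl⟩ := hzw
    cases h with
    | cons hz hl => exact .cons (hz.smul hc) (ih _ hl)

lemma Clockwise.exists_sector (h : Clockwise (z :: w :: l)) :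
    ∃ θ₀ θ₁ : ℝ, θ₁ < θ₀ ∧ θ₀ - θ₁ < 2 * Real.pi ∧ HasArg z θ₀ ∧ HasArg w θ₁ ∧
      ∀ u ∈ l, ∀ θ ∈ Icc θ₁ θ₀, ¬ HasArg u θ := by
  obtain ⟨θ, hanti, hlt, harg⟩ := h
  refine ⟨θ 0, θ 1, hanti Fin.zero_lt_one, hlt 0 1, harg 0, harg 1, fun u hu ϑ hϑ hu' => ?_⟩
  obtain ⟨i, rfl⟩ := List.mem_iff_get.1 hu
  have hi : θ i.succ.succ < θ 1 := hanti (Fin.succ_lt_succ_iff.2 i.succ_pos)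
  have hi' := hlt 0 i.succ.succ
  have := hu'.unique (harg i.succ.succ) (by rw [abs_lt]; constructor <;> linarith [hϑ.1, hϑ.2])
  linarith [hϑ.1]

end Directions

section Arcs

variable {P : Type*} [TopologicalSpace P] {x y z : P}

lemma eq_or_exists_of_trans_apply_eq {γ : Path x y} {δ : Path y z} (hγ : Function.Injective γ)
    (hδ : Function.Injective δ) {s t : unitInterval} (hst : s ≤ t)
    (h : γ.trans δ s = γ.trans δ t) :
    s = t ∨ ∃ u v : unitInterval, (u : ℝ) = 2 * s ∧ (v : ℝ) = 2 * t - 1 ∧ γ u = δ v := by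
  have hst' : (s : ℝ) ≤ t := hst
  by_cases hs : (s : ℝ) ≤ 1 / 2 <;> by_cases ht : (t : ℝ) ≤ 1 / 2 <;>
    simp only [Path.trans_apply, hs, ht, dif_pos, dif_neg, not_false_eq_true] at h
  · have huv := congrArg Subtype.val (hγ h)
    simp only at huv
    exact .inl (Subtype.ext (by linarith))
  · exact .inr ⟨_, _, rfl, rfl, h⟩
  · linarith
  · have huv := congrArg Subtype.val (hδ h)
    simp only at huv
    exact .inl (Subtype.ext (by linarith))

lemma trans_injective {γ : Path x y} {δ : Path y z} (hγ : Function.Injective γ)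
    (hδ : Function.Injective δ) (h : range γ ∩ range δ ⊆ {y}) :
    Function.Injective (γ.trans δ) := by
  intro s t hst
  wlog hle : s ≤ t generalizing s t
  · exact (this hst.symm (le_of_not_ge hle)).symm
  obtain heq | ⟨u, v, hu, hv, huv⟩ := eq_or_exists_of_trans_apply_eq hγ hδ hle hst
  · exact heq
  have hy : γ u = y := h ⟨⟨u, rfl⟩, ⟨v, huv.symm⟩⟩
  obtain rfl : u = 1 := hγ (hy.trans γ.target.symm)
  obtain rfl : v = 0 := hδ (huv.symm.trans (hy.trans δ.source.symm))
  simp only [Icc.coe_one, Icc.coe_zero] at hu hv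
  exact Subtype.ext (by linarith)

lemma isSimpleContour_trans {γ : Path x y} {δ : Path y x} (hγ : Function.Injective γ)
    (hδ : Function.Injective δ) (h : range γ ∩ range δ ⊆ {x, y}) :
    IsSimpleContour (γ.trans δ) := by
  intro s t hst
  wlog hle : s ≤ t generalizing s t
  · rcases this t s hst.symm (le_of_not_ge hle) with h | h | h
    exacts [.inl h.symm, .inr (.inr h.symm), .inr (.inl h.symm)]
  obtain heq | ⟨u, v, hu, hv, huv⟩ := eq_or_exists_of_trans_apply_eq hγ hδ hle hst
  · exact .inl heq
  rcases h ⟨⟨u, rfl⟩, ⟨v, huv.symm⟩⟩ with hx | hy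
  · obtain rfl : u = 0 := hγ (hx.trans γ.source.symm)
    obtain rfl : v = 1 := hδ (huv.symm.trans (hx.trans δ.target.symm))
    simp only [Icc.coe_one, Icc.coe_zero] at hu hv
    exact .inr (.inl ⟨Subtype.ext (by rw [Icc.coe_zero]; linarith),
      Subtype.ext (by rw [Icc.coe_one]; linarith)⟩)
  · obtain rfl : u = 1 := hγ (Eq.trans hy γ.target.symm)
    obtain rfl : v = 0 := hδ (huv.symm.trans (Eq.trans hy δ.source.symm))
    simp only [Icc.coe_one, Icc.coe_zero] at hu hv
    exact .inl (Subtype.ext (by linarith))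

lemma IsSimpleContour.symm {γ : Path x x} (h : IsSimpleContour γ) : IsSimpleContour γ.symm := by
  intro s t hst
  rcases h _ _ hst with h | ⟨hs, ht⟩ | ⟨hs, ht⟩
  · exact .inl (unitInterval.symm_bijective.injective h)
  · exact .inr (.inr ⟨by simpa using congrArg unitInterval.symm hs,
      by simpa using congrArg unitInterval.symm ht⟩)
  · exact .inr (.inl ⟨by simpa using congrArg unitInterval.symm hs,
      by simpa using congrArg unitInterval.symm ht⟩)

lemma contourClass_symm (γ : Path x x) : contourClass γ.symm = (contourClass γ)⁻¹ := rfl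

lemma IsSimpleContour.injective_mul_left {γ : Path x x} (hγ : IsSimpleContour γ)
    {τ : unitInterval} (h0 : 0 < τ) (h1 : τ < 1) : Function.Injective fun t => γ (τ * t) := by
  have hne (t : unitInterval) : τ * t ≠ 1 := (unitInterval.mul_le_left.trans_lt h1).ne
  intro s t h
  rcases hγ _ _ h with h | ⟨-, h⟩ | ⟨h, -⟩
  · have hval := congrArg Subtype.val h
    simp only [Icc.coe_mul] at hval
    exact Subtype.ext (mul_left_cancel₀ (unitInterval.coe_pos.2 h0).ne' hval)
  · exact absurd h (hne t)
  · exact absurd h (hne s)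

/-- The part of a path before the time `τ`, reparametrized to the unit interval. -/
def initialPart (γ : Path x y) (τ : unitInterval) : Path x (γ τ) :=
  (γ.subpath 0 τ).cast γ.source.symm rfl

/-- The part of a path after the time `τ`, reparametrized to the unit interval. -/
def finalPart (γ : Path x y) (τ : unitInterval) : Path (γ τ) y :=
  (γ.subpath τ 1).cast rfl γ.target.symm

lemma initialPart_apply (γ : Path x y) (τ t : unitInterval) : initialPart γ τ t = γ (τ * t) := by
  change γ (Icc.convexComb 0 τ t) = _
  congr 1
  exact Subtype.ext (by simp [mul_comm])

lemma finalPart_apply (γ : Path x y) (τ t : unitInterval) :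
    finalPart γ τ t = γ.symm (unitInterval.symm τ * unitInterval.symm t) := by
  change γ (Icc.convexComb τ 1 t) = γ _
  congr 1
  refine Subtype.ext ?_
  simp only [Icc.coe_convexComb, Icc.coe_one, mul_one, unitInterval.coe_symm_eq, Icc.coe_mul]
  ring

lemma initialPart_injective {γ : Path x x} (hγ : IsSimpleContour γ) {τ : unitInterval}
    (h0 : 0 < τ) (h1 : τ < 1) : Function.Injective (initialPart γ τ) := by
  simpa only [funext (initialPart_apply γ τ)] using hγ.injective_mul_left h0 h1

lemma finalPart_injective {γ : Path x x} (hγ : IsSimpleContour γ) {τ : unitInterval}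
    (h0 : 0 < τ) (h1 : τ < 1) : Function.Injective (finalPart γ τ) := by
  rw [funext (finalPart_apply γ τ)]
  have hpos : 0 < unitInterval.symm τ := by simpa using unitInterval.strictAnti_symm h1
  have hlt : unitInterval.symm τ < 1 := by simpa using unitInterval.strictAnti_symm h0
  exact (hγ.symm.injective_mul_left hpos hlt).comp unitInterval.symm_bijective.injective

lemma range_initialPart_subset (γ : Path x y) (τ : unitInterval) :
    range (initialPart γ τ) ⊆ range γ := by
  rintro _ ⟨t, rfl⟩
  exact ⟨_, rfl⟩

lemma range_finalPart_subset (γ : Path x y) (τ : unitInterval) :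
    range (finalPart γ τ) ⊆ range γ := by
  rintro _ ⟨t, rfl⟩
  exact ⟨_, rfl⟩

lemma homotopic_initialPart_trans_finalPart (γ : Path x y) (τ : unitInterval) :
    ((initialPart γ τ).trans (finalPart γ τ)).Homotopic γ := by
  have h : ((γ.subpath 0 τ).trans (γ.subpath τ 1)).Homotopic (γ.subpath 0 1) :=
    ⟨Path.Homotopy.subpathTransSubpath γ 0 τ 1⟩
  have hcast := h.pathCast γ.source.symm γ.target.symm
  rwa [Path.subpath_zero_one] at hcast

/-- The contour `β` followed by `α`, where the part of `β` after the time `τ` and the part of `α`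
before the time `s` are replaced by the path `η`. -/
def cutCorner (α β : Path x x) (s τ : unitInterval) (η : Path (β τ) (α s)) : Path x x :=
  (initialPart β τ).trans (η.trans (finalPart α s))

variable {α β : Path x x} {s τ : unitInterval} {η : Path (β τ) (α s)}

lemma range_cutCorner_subset : range (cutCorner α β s τ η) ⊆ range α ∪ range β ∪ range η := by
  rw [cutCorner, Path.trans_range, Path.trans_range]
  exact union_subset ((range_initialPart_subset β τ).trans fun x hx => .inl (.inr hx))
    (union_subset subset_union_right ((range_finalPart_subset α s).trans fun x hx =>
      .inl (.inl hx)))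

lemma isSimpleContour_cutCorner (hα : IsSimpleContour α) (hβ : IsSimpleContour β)
    (hαβ : range α ∩ range β ⊆ {x}) (hs0 : 0 < s) (hs1 : s < 1) (hτ0 : 0 < τ) (hτ1 : τ < 1)
    (hη : Function.Injective η) (hηα : range η ∩ range α ⊆ {α s})
    (hηβ : range η ∩ range β ⊆ {β τ}) : IsSimpleContour (cutCorner α β s τ η) := by
  have htail : Function.Injective (η.trans (finalPart α s)) :=
    trans_injective hη (finalPart_injective hα hs0 hs1)
      ((inter_subset_inter_right _ (range_finalPart_subset α s)).trans hηα)
  refine isSimpleContour_trans (initialPart_injective hβ hτ0 hτ1) htail ?_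
  rw [Path.trans_range]
  rintro y ⟨hyβ, hyη | hyα⟩
  · exact .inr (hηβ ⟨hyη, range_initialPart_subset β τ hyβ⟩)
  · exact .inl (hαβ ⟨range_finalPart_subset α s hyα, range_initialPart_subset β τ hyβ⟩)

lemma contourClass_cutCorner (h : ((finalPart β τ).trans (initialPart α s)).Homotopic η) :
    contourClass (cutCorner α β s τ η) = contourClass α * contourClass β := by
  change Path.Homotopic.Quotient.mk _ =
    (Path.Homotopic.Quotient.mk β).trans (Path.Homotopic.Quotient.mk α)
  rw [cutCorner, ← Path.Homotopic.Quotient.eq.2 (homotopic_initialPart_trans_finalPart β τ),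
    ← Path.Homotopic.Quotient.eq.2 (homotopic_initialPart_trans_finalPart α s)]
  simp only [Path.Homotopic.Quotient.mk_trans]
  rw [← Path.Homotopic.Quotient.eq.2 h]
  simp only [Path.Homotopic.Quotient.mk_trans, Path.Homotopic.Quotient.trans_assoc]

end Arcs

section StartsAlong

variable {E : Type*} [NormedAddCommGroup E] [NormedSpace ℝ E] {P : Type*} [TopologicalSpace P]
  {x y z w : P} {φ : OpenPartialHomeomorph P E} {γ : Path x y} {v : E}

/-- In the chart `φ` the path `γ` starts at the origin with constant velocity `v`. -/
def StartsAlong (φ : OpenPartialHomeomorph P E) (γ : Path x y) (v : E) : Prop :=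
  ∃ ε : ℝ, 0 < ε ∧ ∀ t : unitInterval, (t : ℝ) ≤ ε → γ t ∈ φ.source ∧ φ (γ t) = (t : ℝ) • v

lemma StartsAlong.mem_source (h : StartsAlong φ γ v) : x ∈ φ.source := by
  obtain ⟨ε, hε, h⟩ := h
  simpa using (h 0 hε.le).1

lemma StartsAlong.map_eq_zero (h : StartsAlong φ γ v) : φ x = 0 := by
  obtain ⟨ε, hε, h⟩ := h
  simpa using (h 0 hε.le).2

lemma StartsAlong.symm_zero (h : StartsAlong φ γ v) : φ.symm 0 = x := by
  rw [← h.map_eq_zero, φ.left_inv h.mem_source]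

lemma StartsAlong.target_mem_nhds (h : StartsAlong φ γ v) : φ.target ∈ nhds 0 :=
  φ.open_target.mem_nhds (h.map_eq_zero ▸ φ.map_source h.mem_source)

lemma StartsAlong.of_apply_eq_mul {δ : Path z w} (h : StartsAlong φ γ v) (c : unitInterval)
    (hδ : ∀ t, δ t = γ (c * t)) : StartsAlong φ δ ((c : ℝ) • v) := by
  obtain ⟨ε, hε, h⟩ := h
  refine ⟨ε, hε, fun t ht => ?_⟩
  have hle : ((c * t : unitInterval) : ℝ) ≤ ε := le_trans unitInterval.mul_le_right ht
  rw [hδ, (h _ hle).2, Icc.coe_mul, smul_smul, mul_comm (c : ℝ)]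
  exact ⟨(h _ hle).1, rfl⟩

lemma StartsAlong.initialPart (h : StartsAlong φ γ v) (τ : unitInterval) :
    StartsAlong φ (initialPart γ τ) ((τ : ℝ) • v) :=
  h.of_apply_eq_mul τ (initialPart_apply γ τ)

lemma StartsAlong.finalPart_symm (h : StartsAlong φ γ.symm v) (τ : unitInterval) :
    StartsAlong φ (finalPart γ τ).symm ((unitInterval.symm τ : ℝ) • v) :=
  h.of_apply_eq_mul (unitInterval.symm τ) fun t => by
    change HigherArf.finalPart γ τ (unitInterval.symm t) = _
    rw [finalPart_apply, unitInterval.symm_symm]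

lemma StartsAlong.trans (h : StartsAlong φ γ v) (δ : Path y z) :
    StartsAlong φ (γ.trans δ) ((2 : ℝ) • v) := by
  obtain ⟨ε, hε, h⟩ := h
  refine ⟨min (1 / 2) (ε / 2), by positivity, fun t ht => ?_⟩
  obtain ⟨ht1, htε⟩ := le_min_iff.1 ht
  have happly := h ⟨2 * t, by linarith [t.2.1], by linarith⟩ (by simp only; linarith)
  rwa [Path.trans_apply, dif_pos ht1, smul_smul, mul_comm (t : ℝ)]

end StartsAlong

section StraightContours

variable {P : Type*} [TopologicalSpace P] {p : P} {φ : OpenPartialHomeomorph P ℂ}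

lemma hasEnds_iff {γ : Path p p} {out inn : ℂ} :
    HasEnds φ γ out inn ↔ StartsAlong φ γ out ∧ StartsAlong φ γ.symm inn := by
  constructor
  · rintro ⟨ε, hε, h⟩
    exact ⟨⟨ε, hε, fun t ht => (h t ht).1⟩, ⟨ε, hε, fun t ht => (h t ht).2⟩⟩
  · rintro ⟨⟨ε, hε, h⟩, ⟨ε', hε', h'⟩⟩
    exact ⟨min ε ε', lt_min hε hε', fun t ht =>
      ⟨h t (ht.trans (min_le_left _ _)), h' t (ht.trans (min_le_right _ _))⟩⟩

/-- A simple contour which in the chart `φ` is straight near the base point, with the directions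
`out` and `inn` of its ends. -/
structure IsStraightContour (φ : OpenPartialHomeomorph P ℂ) (γ : Path p p) (out inn : ℂ) :
    Prop where
  isSimpleContour : IsSimpleContour γ
  hasEnds : HasEnds φ γ out inn

namespace IsStraightContour

variable {γ : Path p p} {out inn : ℂ}

lemma startsAlong (h : IsStraightContour φ γ out inn) : StartsAlong φ γ out :=
  (hasEnds_iff.1 h.hasEnds).1

lemma startsAlong_symm (h : IsStraightContour φ γ out inn) : StartsAlong φ γ.symm inn :=
  (hasEnds_iff.1 h.hasEnds).2

lemma symm (h : IsStraightContour φ γ out inn) : IsStraightContour φ γ.symm inn out :=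
  ⟨h.isSimpleContour.symm, hasEnds_iff.2 ⟨h.startsAlong_symm, γ.symm_symm.symm ▸ h.startsAlong⟩⟩

end IsStraightContour

lemma hasEnds_cutCorner {α β : Path p p} {αIn βOut : ℂ} {s τ : unitInterval}
    {η : Path (β τ) (α s)} (hα : StartsAlong φ α.symm αIn) (hβ : StartsAlong φ β βOut) :
    HasEnds φ (cutCorner α β s τ η) ((2 * τ : ℝ) • βOut)
      ((4 * unitInterval.symm s : ℝ) • αIn) := by
  refine hasEnds_iff.2 ⟨?_, ?_⟩
  · have hout := (hβ.initialPart τ).trans (η.trans (finalPart α s))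
    rwa [smul_smul] at hout
  · have hsymm := ((hα.finalPart_symm s).trans η.symm).trans (initialPart β τ).symm
    rw [smul_smul, smul_smul, show (2 : ℝ) * 2 = 4 by norm_num] at hsymm
    rwa [cutCorner, Path.trans_symm, Path.trans_symm]

end StraightContours

section Corners

open Filter Topology

variable {P : Type*} [TopologicalSpace P] {p : P} {φ : OpenPartialHomeomorph P ℂ}
  {α β γ : Path p p} {v out inn αOut αIn βOut βIn : ℂ} {r θ θ₀ θ₁ : ℝ}

lemma IsStraightContour.eventually_eq_smul [T2Space P] (h : IsStraightContour φ γ out inn) :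
    ∀ᶠ z in 𝓝 (0 : ℂ), ∀ t, γ t = φ.symm z → z = (t : ℝ) • out ∨ z = (1 - t : ℝ) • inn := by
  obtain ⟨ε, hε, hends⟩ := h.hasEnds
  let K : Set P := γ '' {t : unitInterval | ε ≤ t ∧ ε ≤ 1 - (t : ℝ)}
  have hK : IsClosed K := by
    refine (IsCompact.image (IsClosed.isCompact ?_) γ.continuous).isClosed
    exact (isClosed_le continuous_const continuous_subtype_val).inter
      (isClosed_le continuous_const (continuous_const.sub continuous_subtype_val))
  have hpK : φ.symm 0 ∉ K := by
    rw [h.startsAlong.symm_zero]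
    rintro ⟨t, ⟨ht, ht'⟩, htp⟩
    rcases h.isSimpleContour t 0 (htp.trans γ.source.symm) with rfl | ⟨rfl, -⟩ | ⟨rfl, -⟩
    · exact hε.not_ge ht
    · exact hε.not_ge ht
    · exact hε.not_ge (by simpa using ht')
  have htarget := h.startsAlong.target_mem_nhds
  filter_upwards [htarget, (φ.continuousAt_symm (mem_of_mem_nhds htarget)).preimage_mem_nhds
    (hK.isOpen_compl.mem_nhds hpK)] with z hz hzK t ht
  have hφ : φ (γ t) = z := by rw [ht, φ.right_inv hz]
  by_cases htε : (t : ℝ) ≤ ε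
  · exact .inl (hφ.symm.trans (hends t htε).1.2)
  by_cases htε' : 1 - (t : ℝ) ≤ ε
  · have hsymm := (hends (unitInterval.symm t) htε').2.2
    rw [unitInterval.symm_symm, hφ] at hsymm
    exact .inr hsymm
  · exact absurd ⟨t, ⟨(not_le.1 htε).le, (not_le.1 htε').le⟩, ht⟩ hzK

lemma eventually_circleMap_mem {S : Set ℂ} (hS : S ∈ 𝓝 0) :
    ∀ᶠ r in 𝓝[>] (0 : ℝ), ∀ θ, circleMap 0 r θ ∈ S := by
  filter_upwards [self_mem_nhdsWithin,
    (eventually_closedBall_subset hS).filter_mono nhdsWithin_le_nhds] with r hr hrS θ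
  exact hrS (circleMap_mem_closedBall 0 (mem_Ioi.1 hr).le θ)

lemma IsStraightContour.eventually_hasArg [T2Space P] (h : IsStraightContour φ γ out inn) :
    ∀ᶠ r in 𝓝[>] (0 : ℝ), ∀ θ, φ.symm (circleMap 0 r θ) ∈ range γ →
      HasArg out θ ∨ HasArg inn θ := by
  filter_upwards [self_mem_nhdsWithin, eventually_circleMap_mem h.eventually_eq_smul]
    with r hr hsmul θ ⟨t, ht⟩
  have harg := hasArg_circleMap hr θ
  rcases hsmul θ t ht with hout | hinn
  · exact .inl (.of_smul t.2.1 (hout ▸ harg))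
  · exact .inr (.of_smul (sub_nonneg.2 t.2.2) (hinn ▸ harg))

lemma StartsAlong.eventually_exists_apply_eq {x y : P} {γ : Path x y} (h : StartsAlong φ γ v)
    (hv : HasArg v θ) : ∀ᶠ r in 𝓝[>] (0 : ℝ), ∃ s : unitInterval, 0 < s ∧ s < 1 ∧
      γ s = φ.symm (circleMap 0 r θ) ∧
      ∀ t ≤ s, γ t ∈ φ.source ∧ φ (γ t) ∈ Metric.closedBall 0 r := by
  obtain ⟨ε, hε, h⟩ := h
  have hv0 : 0 < ‖v‖ := norm_pos_iff.2 hv.ne_zero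
  filter_upwards [Ioo_mem_nhdsGT (show 0 < min ε 1 * ‖v‖ by positivity)] with r ⟨hr0, hr⟩
  rw [← div_lt_iff₀ hv0, lt_min_iff] at hr
  have hs0 : 0 < r / ‖v‖ := by positivity
  refine ⟨⟨r / ‖v‖, hs0.le, hr.2.le⟩, hs0, hr.2, ?_, fun t ht => ?_⟩
  · obtain ⟨hsource, happly⟩ := h ⟨r / ‖v‖, hs0.le, hr.2.le⟩ hr.1.le
    rw [← hv.div_norm_smul, ← happly, φ.left_inv hsource]
  · have ht' : (t : ℝ) ≤ r / ‖v‖ := ht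
    obtain ⟨hsource, happly⟩ := h t (ht'.trans hr.1.le)
    refine ⟨hsource, ?_⟩
    rwa [happly, mem_closedBall_zero_iff, norm_smul, Real.norm_of_nonneg t.2.1,
      ← le_div_iff₀ hv0]

/-- The arc of the circle of radius `r` around the origin of the chart `φ` from the argument `θ₀`
to the argument `θ₁`. -/
def circleArc (hr : ∀ θ, circleMap 0 r θ ∈ φ.target) (θ₀ θ₁ : ℝ) :
    Path (φ.symm (circleMap 0 r θ₀)) (φ.symm (circleMap 0 r θ₁)) where
  toFun u := φ.symm (circleMap 0 r (AffineMap.lineMap θ₀ θ₁ (u : ℝ)))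
  continuous_toFun := φ.continuousOn_symm.comp_continuous
    ((continuous_circleMap 0 r).comp (by fun_prop)) fun _ => hr _
  source' := by simp
  target' := by simp

lemma circleArc_apply (hr : ∀ θ, circleMap 0 r θ ∈ φ.target) (θ₀ θ₁ : ℝ) (u : unitInterval) :
    circleArc hr θ₀ θ₁ u = φ.symm (circleMap 0 r (AffineMap.lineMap θ₀ θ₁ (u : ℝ))) := rfl

lemma lineMap_mem_Icc (h : θ₁ ≤ θ₀) (u : unitInterval) :
    AffineMap.lineMap θ₀ θ₁ (u : ℝ) ∈ Icc θ₁ θ₀ := by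
  rw [← segment_eq_Icc h, segment_symm, segment_eq_image_lineMap]
  exact mem_image_of_mem _ u.2

lemma circleArc_injective (hr : ∀ θ, circleMap 0 r θ ∈ φ.target) (hr0 : r ≠ 0) (h01 : θ₁ < θ₀)
    (h2π : θ₀ - θ₁ < 2 * Real.pi) : Function.Injective (circleArc hr θ₀ θ₁) := by
  intro u u' h
  have hu := lineMap_mem_Icc h01.le u
  have hu' := lineMap_mem_Icc h01.le u'
  have hangle := eq_of_circleMap_eq hr0
    (by rw [abs_lt]; constructor <;> linarith [hu.1, hu.2, hu'.1, hu'.2])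
    (φ.symm.injOn (hr _) (hr _) h)
  exact Subtype.ext (AffineMap.lineMap_injective ℝ h01.ne' hangle)

lemma range_circleArc_inter_subset (hr : ∀ θ, circleMap 0 r θ ∈ φ.target) {S : Set P}
    {v w : ℂ} {ϑ : ℝ} (hS : ∀ θ, φ.symm (circleMap 0 r θ) ∈ S → HasArg v θ ∨ HasArg w θ)
    (h01 : θ₁ ≤ θ₀) (h2π : θ₀ - θ₁ < 2 * Real.pi) (hv : HasArg v ϑ) (hϑ : ϑ ∈ Icc θ₁ θ₀)
    (hw : ∀ θ ∈ Icc θ₁ θ₀, ¬ HasArg w θ) :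
    range (circleArc hr θ₀ θ₁) ∩ S ⊆ {φ.symm (circleMap 0 r ϑ)} := by
  rintro _ ⟨⟨u, rfl⟩, hu⟩
  have hmem := lineMap_mem_Icc h01 u
  have hvu := (hS _ hu).resolve_right (hw _ hmem)
  rw [mem_singleton_iff, circleArc_apply, hvu.unique hv
    (by rw [abs_lt]; constructor <;> linarith [hmem.1, hmem.2, hϑ.1, hϑ.2])]

lemma finalPart_trans_initialPart_mem {S : Set P} {s s' : unitInterval}
    (hα : ∀ t ≤ s, α t ∈ S) (hβ : ∀ t ≤ s', β.symm t ∈ S) (t : unitInterval) :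
    (finalPart β (unitInterval.symm s')).trans (initialPart α s) t ∈ S := by
  suffices h : range ((finalPart β (unitInterval.symm s')).trans (initialPart α s)) ⊆ S from
    h ⟨t, rfl⟩
  rw [Path.trans_range]
  rintro _ (⟨u, rfl⟩ | ⟨u, rfl⟩)
  · rw [finalPart_apply, unitInterval.symm_symm]
    exact hβ _ unitInterval.mul_le_left
  · rw [initialPart_apply]
    exact hα _ unitInterval.mul_le_left

/-- Rounding off the corner at `p` by an arc of a small circle. -/
theorem IsStraightContour.eventually_exists_mul [T2Space P]
    (hα : IsStraightContour φ α αOut αIn) (hβ : IsStraightContour φ β βOut βIn)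
    (hαβ : range α ∩ range β ⊆ {p}) {l : List ℂ} (hl : Clockwise (βIn :: αOut :: l))
    (hαl : αIn ∈ l) (hβl : βOut ∈ l) :
    ∀ᶠ r in 𝓝[>] (0 : ℝ), ∃ (δ : Path p p) (k k' : ℝ), 0 < k ∧ 0 < k' ∧
      IsStraightContour φ δ (k • βOut) (k' • αIn) ∧
      contourClass δ = contourClass α * contourClass β ∧
      range δ ⊆ range α ∪ range β ∪
        (φ.symm ∘ circleMap 0 r) '' {θ | ∀ u ∈ l, ¬ HasArg u θ} := by
  obtain ⟨θ₀, θ₁, h01, h2π, h₀, h₁, hfree⟩ := hl.exists_sector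
  filter_upwards [self_mem_nhdsWithin, hα.eventually_hasArg, hβ.eventually_hasArg,
    (eventually_closedBall_subset hα.startsAlong.target_mem_nhds).filter_mono
      nhdsWithin_le_nhds, hα.startsAlong.eventually_exists_apply_eq h₁,
    hβ.startsAlong_symm.eventually_exists_apply_eq h₀]
    with r hr0 hαr hβr htarget ⟨s, hs0, hs1, hs, hαs⟩ ⟨s', hs'0, hs'1, hs', hβs'⟩
  have hr (θ : ℝ) : circleMap 0 r θ ∈ φ.target :=
    htarget (circleMap_mem_closedBall 0 (mem_Ioi.1 hr0).le θ)
  let τ := unitInterval.symm s'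
  have hτ0 : 0 < τ := by simpa using unitInterval.strictAnti_symm hs'1
  have hτ1 : τ < 1 := by simpa using unitInterval.strictAnti_symm hs'0
  have hsσ : 0 < unitInterval.symm s := by simpa using unitInterval.strictAnti_symm hs1
  let η : Path (β τ) (α s) := (circleArc hr θ₀ θ₁).cast hs' hs
  have hηα : range η ∩ range α ⊆ {α s} :=
    (range_circleArc_inter_subset hr hαr h01.le h2π h₁ (left_mem_Icc.2 h01.le)
      (hfree _ hαl)).trans_eq
      (congrArg singleton hs.symm)
  have hηβ : range η ∩ range β ⊆ {β τ} :=
    (range_circleArc_inter_subset hr (fun θ h => (hβr θ h).symm) h01.le h2π h₀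
      (right_mem_Icc.2 h01.le) (hfree _ hβl)).trans_eq (congrArg singleton hs'.symm)
  have hsimple : IsSimpleContour (cutCorner α β s τ η) :=
    isSimpleContour_cutCorner hα.isSimpleContour hβ.isSimpleContour hαβ hs0 hs1 hτ0 hτ1
      (circleArc_injective hr (mem_Ioi.1 hr0).ne' h01 h2π) hηα hηβ
  have hhom : ((finalPart β τ).trans (initialPart α s)).Homotopic η := by
    refine homotopic_of_mem_convex φ (convex_closedBall 0 r) htarget _ _
      (finalPart_trans_initialPart_mem (S := {x | x ∈ φ.source ∧ φ x ∈ Metric.closedBall 0 r})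
        hαs hβs') fun u => ⟨φ.map_target (hr _), ?_⟩
    change φ (circleArc hr θ₀ θ₁ u) ∈ _
    rw [circleArc_apply, φ.right_inv (hr _)]
    exact circleMap_mem_closedBall 0 (mem_Ioi.1 hr0).le _
  refine ⟨cutCorner α β s τ η, 2 * τ, 4 * unitInterval.symm s, ?_, ?_,
    ⟨hsimple, hasEnds_cutCorner hα.startsAlong_symm hβ.startsAlong⟩, contourClass_cutCorner hhom,
    range_cutCorner_subset.trans (union_subset_union_right _ ?_)⟩
  · exact mul_pos two_pos hτ0
  · exact mul_pos four_pos hsσ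
  · rintro _ ⟨u, rfl⟩
    exact ⟨_, fun v hv => hfree v hv _ (lineMap_mem_Icc h01.le u), rfl⟩

end Corners

section Presentation

variable {G H : Type*} [Group G] [Group H] {g n : ℕ} {v : Family G g n}

lemma Family.free_map_lift (w : Family H g n) :
    (Family.free g n).map (FreeGroup.lift w.get) = w := by
  ext <;> simp [Family.map, Family.free, Family.get]

lemma Family.relator_map (v : Family G g n) (f : G →* H) : (v.map f).relator = f v.relator := by
  simp [Family.relator, Family.map, groupComm, map_list_prod, List.map_ofFn, Function.comp_def]

lemma Family.relator_eq_one_of_c_eq_one {A : Type*} [CommGroup A] {w : Family A g n}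
    (hw : w.c = 1) : w.relator = 1 := by
  have hcomm (x y : A) : groupComm x y = 1 := by
    rw [groupComm, mul_comm x y, mul_inv_cancel_right, mul_inv_cancel]
  simp [Family.relator, hcomm, hw, List.prod_ofFn]

lemma Family.IsPresentation.exists_map_eq (hv : v.IsPresentation) {w : Family H g n}
    (hw : w.relator = 1) : ∃ χ : G →* H, v.map χ = w := by
  have hker : (FreeGroup.lift v.get).ker ≤ (FreeGroup.lift w.get).ker := by
    rw [hv.2]
    refine Subgroup.normalClosure_le_normal (singleton_subset_iff.2 ?_)
    rw [SetLike.mem_coe, MonoidHom.mem_ker, ← Family.relator_map, Family.free_map_lift, hw]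
  let χ : G →* H := (FreeGroup.lift v.get).liftOfSurjective hv.1 ⟨_, hker⟩
  have hχ (i) : χ (v.get i) = w.get i := by
    simpa using MonoidHom.liftOfRightInverse_comp_apply (FreeGroup.lift v.get) _
      (Function.rightInverse_surjInv hv.1) ⟨_, hker⟩ (.of i)
  exact ⟨χ, Family.ext (funext fun i => hχ (.inl i)) (funext fun i => hχ (.inr (.inl i)))
    (funext fun j => hχ (.inr (.inr j)))⟩

lemma Family.IsPresentation.exists_hom_int (hv : v.IsPresentation) :
    ∃ χ : G →* Multiplicative ℤ, (∀ i, χ (v.a i) = 1) ∧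
      (∀ i, χ (v.b i) = Multiplicative.ofAdd 1) ∧ ∀ j, χ (v.c j) = 1 := by
  obtain ⟨χ, hχ⟩ := hv.exists_map_eq (Family.relator_eq_one_of_c_eq_one
    (w := ⟨1, fun _ => Multiplicative.ofAdd (1 : ℤ), 1⟩) rfl)
  exact ⟨χ, congrFun (congrArg Family.a hχ), congrFun (congrArg Family.b hχ),
    congrFun (congrArg Family.c hχ)⟩

lemma Family.IsPresentation.b_mul_inv_a_ne_one (hv : v.IsPresentation) (i j : Fin g) :
    v.b i * (v.a j)⁻¹ ≠ 1 := by
  obtain ⟨χ, ha, hb, -⟩ := hv.exists_hom_int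
  exact fun h => by simpa [ha, hb] using congrArg χ h

lemma Family.IsPresentation.b_mul_a_ne_one (hv : v.IsPresentation) (i : Fin g) :
    v.b i * v.a i ≠ 1 := by
  obtain ⟨χ, ha, hb, -⟩ := hv.exists_hom_int
  exact fun h => by simpa [ha, hb] using congrArg χ h

lemma Family.IsPresentation.inv_c_mul_b_mul_a_ne_one (hv : v.IsPresentation) (i : Fin g)
    (j : Fin n) : (v.c j)⁻¹ * (v.b i * v.a i) ≠ 1 := by
  obtain ⟨χ, ha, hb, hc⟩ := hv.exists_hom_int
  exact fun h => by simpa [ha, hb, hc] using congrArg χ h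

end Presentation

section Pairs

variable {P : Type*} [TopologicalSpace P] {p : P} {x y : FundamentalGroup P p}

lemma inv_mem_simpleClasses (hx : x ∈ simpleClasses P p) : x⁻¹ ∈ simpleClasses P p := by
  obtain ⟨hx1, α, hα, rfl⟩ := hx
  exact ⟨inv_ne_one.2 hx1, α.symm, hα.symm, contourClass_symm α⟩

instance : Inv (simpleClasses P p) := ⟨fun x => ⟨(x : FundamentalGroup P p)⁻¹,
  inv_mem_simpleClasses x.2⟩⟩

lemma localIndex_ne_zero_iff {aIn aOut bIn bOut : ℂ} : localIndex aIn aOut bIn bOut ≠ 0 ↔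
    Clockwise [aIn, bOut, aOut, bIn] ∨ Clockwise [aIn, bIn, aOut, bOut] := by
  unfold localIndex
  split_ifs <;> simp [*]

variable [ChartedSpace ℂ P] {R R' : ℂ → ℂ → ℂ → ℂ → Prop}

lemma MeetOnce.mono (h : MeetOnce x y R)
    (hR : ∀ xIn xOut yIn yOut, R xIn xOut yIn yOut → R' xIn xOut yIn yOut) :
    MeetOnce x y R' := by
  obtain ⟨α, β, φ, xIn, xOut, yIn, yOut, hα, hβ, hx, hy, hαβ, hφ, eα, eβ, h⟩ := h
  exact ⟨α, β, φ, xIn, xOut, yIn, yOut, hα, hβ, hx, hy, hαβ, hφ, eα, eβ, hR _ _ _ _ h⟩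

lemma MeetOnce.symm (h : MeetOnce x y R) :
    MeetOnce y x fun yIn yOut xIn xOut => R xIn xOut yIn yOut := by
  obtain ⟨α, β, φ, xIn, xOut, yIn, yOut, hα, hβ, hx, hy, hαβ, hφ, eα, eβ, h⟩ := h
  exact ⟨β, α, φ, yIn, yOut, xIn, xOut, hβ, hα, hy, hx, by rwa [inter_comm], hφ, eβ, eα, h⟩

lemma MeetOnce.inv_right (h : MeetOnce x y R) :
    MeetOnce x y⁻¹ fun xIn xOut yIn yOut => R xIn xOut yOut yIn := by
  obtain ⟨α, β, φ, xIn, xOut, yIn, yOut, hα, hβ, hx, rfl, hαβ, hφ, eα, eβ, h⟩ := h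
  have hβ' : IsStraightContour φ β.symm yIn yOut := IsStraightContour.symm ⟨hβ, eβ⟩
  exact ⟨α, β.symm, φ, xIn, xOut, yOut, yIn, hα, hβ'.isSimpleContour, hx, contourClass_symm β,
    by rwa [Path.symm_range], hφ, eα, hβ'.hasEnds, h⟩

lemma MeetOnce.mul_mem_simpleClasses [T2Space P]
    (h : MeetOnce x y fun xIn xOut yIn yOut =>
      ∃ l, Clockwise (yIn :: xOut :: l) ∧ xIn ∈ l ∧ yOut ∈ l) (hxy : x * y ≠ 1) :
    x * y ∈ simpleClasses P p := by
  obtain ⟨α, β, φ, xIn, xOut, yIn, yOut, hα, hβ, rfl, rfl, hαβ, -, eα, eβ, l, hl, hx, hy⟩ := h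
  obtain ⟨r, δ, _, _, -, -, hδ, hclass, -⟩ :=
    (IsStraightContour.eventually_exists_mul ⟨hα, eα⟩ ⟨hβ, eβ⟩ hαβ.subset hl hx hy).exists
  exact ⟨hxy, δ, hδ.isSimpleContour, hclass⟩

lemma IsCrossingPair.symm (h : IsCrossingPair x y) : IsCrossingPair y x := by
  refine MeetOnce.mono (MeetOnce.symm h) fun yIn yOut xIn xOut h => ?_
  rw [localIndex_ne_zero_iff] at h ⊢
  rcases h with h | h
  · exact .inr (h.rotate (l := [xIn, yOut, xOut]))
  · have h₁ : Clockwise [yOut, xIn, yIn, xOut] := h.rotate (l := [xIn, yIn, xOut])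
    have h₂ : Clockwise [xOut, yOut, xIn, yIn] := h₁.rotate (l := [yOut, xIn, yIn])
    exact .inl (h₂.rotate (l := [xOut, yOut, xIn]))

lemma IsCrossingPair.inv_right (h : IsCrossingPair x y) : IsCrossingPair x y⁻¹ :=
  MeetOnce.mono (MeetOnce.inv_right h) fun _ _ _ _ h =>
    localIndex_ne_zero_iff.2 (localIndex_ne_zero_iff.1 h).symm

lemma IsNegativePair.symm (h : IsNegativePair x y) : IsNegativePair y x :=
  MeetOnce.mono (MeetOnce.symm h) fun yIn yOut xIn xOut h => by
    have h' : Clockwise [yIn, xOut, xIn, yOut] := h.rotate (l := [xOut, xIn, yOut])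
    exact h'.rotate (l := [yIn, xOut, xIn])

lemma IsNegativePair.mul_mem_simpleClasses [T2Space P] (h : IsNegativePair x y)
    (hxy : x * y ≠ 1) : x * y ∈ simpleClasses P p :=
  MeetOnce.mul_mem_simpleClasses (MeetOnce.mono h fun xIn xOut _ yOut h =>
    ⟨[xIn, yOut], h.rotate (l := [xOut, xIn, yOut]), by simp, by simp⟩) hxy

lemma isNegativePair_contourClass_mul [T2Space P] {φ : OpenPartialHomeomorph P ℂ}
    {α β γ : Path p p} {αOut αIn βOut βIn γOut γIn : ℂ}
    (hφ : φ ∈ IsManifold.maximalAtlas 𝓘(ℂ) ω P) (hα : IsStraightContour φ α αOut αIn)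
    (hβ : IsStraightContour φ β βOut βIn) (hγ : IsStraightContour φ γ γOut γIn)
    (hαβ : range α ∩ range β = {p}) (hαγ : range α ∩ range γ = {p})
    (hβγ : range β ∩ range γ = {p}) (h : Clockwise [βIn, αOut, βOut, αIn, γOut, γIn]) :
    IsNegativePair (contourClass α * contourClass β) (contourClass γ) := by
  obtain ⟨r, hγr, δ, k, k', hk, hk', hδ, hclass, hrange⟩ := (hγ.eventually_hasArg.and
    (hα.eventually_exists_mul hβ hαβ.subset h (by simp) (by simp))).exists
  have hδγ : range δ ∩ range γ ⊆ {p} := by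
    rintro z ⟨hzδ, hzγ⟩
    rcases hrange hzδ with (hzα | hzβ) | ⟨θ, hθ, rfl⟩
    · exact hαγ.subset ⟨hzα, hzγ⟩
    · exact hβγ.subset ⟨hzβ, hzγ⟩
    · exact ((hγr θ hzγ).elim (hθ γOut (by simp)) (hθ γIn (by simp))).elim
  have hends : Clockwise [βOut, αIn, γOut, γIn] := h.sublist (by simp)
  refine ⟨δ, γ, φ, k' • αIn, k • βOut, γIn, γOut, hδ.isSimpleContour, hγ.isSimpleContour, hclass,
    rfl, hδγ.antisymm ?_, hφ, hδ.hasEnds, hγ.hasEnds, hends.of_forall₂_smul ?_⟩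
  · exact singleton_subset_iff.2 ⟨⟨0, δ.source⟩, ⟨0, γ.source⟩⟩
  · exact .cons ⟨k, hk, rfl⟩ (.cons ⟨k', hk', rfl⟩
      (.cons ⟨1, one_pos, (one_smul ℝ _).symm⟩ (.cons ⟨1, one_pos, (one_smul ℝ _).symm⟩ .nil)))

end Pairs

section BasisEnds

variable {X : Type*} {g n : ℕ} (out inn : Family ℂ g n)

lemma sublist_flatten_ofFn (F : Fin n → List X) (i : Fin n) :
    (F i).Sublist (List.ofFn F).flatten := by
  have h : [F i].Sublist (List.ofFn F) := List.singleton_sublist.2 (List.mem_ofFn.2 ⟨i, rfl⟩)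
  simpa using h.flatten

lemma append_sublist_flatten_ofFn (F : Fin n → List X) {i j : Fin n} (hij : i < j) :
    (F i ++ F j).Sublist (List.ofFn F).flatten := by
  have hsub : [i, j].Sublist (List.finRange n) := by
    refine List.sublist_of_subperm_of_sortedLE ?_ ?_ (List.sortedLT_finRange n).sortedLE
    · exact List.Nodup.subperm (by simp [hij.ne]) (by simp)
    · simp [List.sortedLE_iff_pairwise, hij.le]
  have h : [F i, F j].Sublist (List.ofFn F) := by
    rw [List.ofFn_eq_map]
    exact hsub.map F
  simpa using h.flatten

lemma handle_sublist_basisEnds (i : Fin g) :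
    [inn.a i, out.b i, out.a i, inn.b i].Sublist (basisEnds out inn) :=
  (sublist_flatten_ofFn (fun i => [inn.a i, out.b i, out.a i, inn.b i]) i).trans
    (List.sublist_append_left _ _)

lemma handles_sublist_basisEnds {i j : Fin g} (h : i < j) :
    [inn.a i, out.b i, out.a i, inn.b i, inn.a j, out.b j, out.a j, inn.b j].Sublist
      (basisEnds out inn) :=
  (append_sublist_flatten_ofFn (fun i => [inn.a i, out.b i, out.a i, inn.b i]) h).trans
    (List.sublist_append_left _ _)

lemma handle_boundary_sublist_basisEnds (i : Fin g) (j : Fin n) :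
    [inn.a i, out.b i, out.a i, inn.b i, inn.c j, out.c j].Sublist (basisEnds out inn) :=
  (sublist_flatten_ofFn (fun i => [inn.a i, out.b i, out.a i, inn.b i]) i).append
    (sublist_flatten_ofFn (fun j => [inn.c j, out.c j]) j)

end BasisEnds

section StandardBasis

variable {P : Type*} [TopologicalSpace P] {p : P} [ChartedSpace ℂ P] {g lh lp : ℕ}
  {v : Family (simpleClasses P p) g (lh + lp)}

namespace IsStandardBasis

lemma closure_simpleClasses (hv : IsStandardBasis v) :
    Subgroup.closure (simpleClasses P p) = ⊤ := by
  rw [← top_le_iff, ← MonoidHom.range_eq_top.2 hv.1.1, FreeGroup.range_lift_eq_closure]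
  refine Subgroup.closure_mono ?_
  rintro _ ⟨i | i | i, rfl⟩
  exacts [(v.a i).2, (v.b i).2, (v.c i).2]

lemma meetOnce (hv : IsStandardBasis v) {i j : Fin g ⊕ Fin g ⊕ Fin (lh + lp)} (hij : i ≠ j)
    {R : ℂ → ℂ → ℂ → ℂ → Prop}
    (hR : ∀ out inn : Family ℂ g (lh + lp), Clockwise (basisEnds out inn) →
      R (inn.get i) (out.get i) (inn.get j) (out.get j)) :
    MeetOnce (v.get i : FundamentalGroup P p) (v.get j) R := by
  obtain ⟨-, κ, hs, hc, hm, -, -, φ, out, inn, hφ, he, hcw⟩ := hv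
  exact ⟨κ.get i, κ.get j, φ, _, _, _, _, hs i, hs j, hc i, hc j, hm i j hij, hφ, he i, he j,
    hR out inn hcw⟩

lemma isCrossingPair_a_b (hv : IsStandardBasis v) (i : Fin g) :
    IsCrossingPair (v.a i : FundamentalGroup P p) (v.b i) :=
  hv.meetOnce (i := .inl i) (j := .inr (.inl i)) (by simp) fun out inn h =>
    localIndex_ne_zero_iff.2 (.inl (h.sublist (handle_sublist_basisEnds out inn i)))

lemma isNegativePair_b_inv_a (hv : IsStandardBasis v) {i j : Fin g} (hij : i ≠ j) :
    IsNegativePair (v.b i : FundamentalGroup P p) (v.a j : FundamentalGroup P p)⁻¹ := by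
  refine MeetOnce.inv_right (hv.meetOnce (i := .inr (.inl i)) (j := .inl j)
    (R := fun bIn bOut aIn aOut => Clockwise [bOut, bIn, aIn, aOut]) (by simp)
    fun out inn h => ?_)
  rcases hij.lt_or_gt with hlt | hgt
  · have hsub : [out.b i, inn.b i, inn.a j, out.a j].Sublist (basisEnds out inn) :=
      .trans (.cons _ (.cons_cons _ (.cons _ (.cons_cons _ (.cons_cons _ (.cons _ (.cons_cons _
        (.cons _ .slnil)))))))) (handles_sublist_basisEnds out inn hlt)
    exact h.sublist hsub
  · have hsub : [inn.a j, out.a j, out.b i, inn.b i].Sublist (basisEnds out inn) :=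
      .trans (.cons_cons _ (.cons _ (.cons_cons _ (.cons _ (.cons _ (.cons_cons _ (.cons _
        (.cons_cons _ .slnil)))))))) (handles_sublist_basisEnds out inn hgt)
    have h' : Clockwise [inn.b i, inn.a j, out.a j, out.b i] :=
      (h.sublist hsub).rotate (l := [inn.a j, out.a j, out.b i])
    exact h'.rotate (l := [inn.b i, inn.a j, out.a j])

lemma b_mul_inv_a_mem_simpleClasses [T2Space P] (hv : IsStandardBasis v) {i j : Fin g}
    (hij : i ≠ j) :
    (v.b i : FundamentalGroup P p) * (v.a j : FundamentalGroup P p)⁻¹ ∈ simpleClasses P p :=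
  (hv.isNegativePair_b_inv_a hij).mul_mem_simpleClasses (hv.1.b_mul_inv_a_ne_one i j)

lemma b_mul_a_mem_simpleClasses [T2Space P] (hv : IsStandardBasis v) (i : Fin g) :
    (v.b i : FundamentalGroup P p) * (v.a i : FundamentalGroup P p) ∈ simpleClasses P p :=
  (hv.meetOnce (i := .inr (.inl i)) (j := .inl i) (by simp) fun out inn h =>
    ⟨[out.a i, inn.b i], h.sublist (handle_sublist_basisEnds out inn i), by simp [Family.get],
      by simp [Family.get]⟩).mul_mem_simpleClasses (hv.1.b_mul_a_ne_one i)

lemma isNegativePair_inv_c_b_mul_a [T2Space P] (hv : IsStandardBasis v) (i : Fin g)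
    (j : Fin (lh + lp)) : IsNegativePair (v.c j : FundamentalGroup P p)⁻¹
      ((v.b i : FundamentalGroup P p) * (v.a i : FundamentalGroup P p)) := by
  obtain ⟨-, κ, hs, hc, hm, -, -, φ, out, inn, hφ, he, hcw⟩ := hv
  have hstraight (k) : IsStraightContour φ (κ.get k) (out.get k) (inn.get k) := ⟨hs k, he k⟩
  have hbc := hm (.inr (.inl i)) (.inr (.inr j)) (by simp)
  have hac := hm (.inl i) (.inr (.inr j)) (by simp)
  rw [← Path.symm_range (κ.get (.inr (.inr j)))] at hbc hac
  have hneg := isNegativePair_contourClass_mul hφ (hstraight (.inr (.inl i)))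
    (hstraight (.inl i)) (hstraight (.inr (.inr j))).symm (hm _ _ (by simp)) hbc hac
    (hcw.sublist (handle_boundary_sublist_basisEnds out inn i j))
  rw [contourClass_symm, hc, hc, hc] at hneg
  exact hneg.symm

lemma inv_c_mul_b_mul_a_mem_simpleClasses [T2Space P] (hv : IsStandardBasis v) (i : Fin g)
    (j : Fin (lh + lp)) : (v.c j : FundamentalGroup P p)⁻¹ *
      ((v.b i : FundamentalGroup P p) * (v.a i : FundamentalGroup P p)) ∈ simpleClasses P p :=
  (hv.isNegativePair_inv_c_b_mul_a i j).mul_mem_simpleClasses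
    (hv.1.inv_c_mul_b_mul_a_ne_one i j)

end IsStandardBasis

end StandardBasis

section ArfFunctions

variable {P : Type*} [TopologicalSpace P] {p : P} [ChartedSpace ℂ P] {m : ℕ}
  {σ : simpleClasses P p → ZMod m} {g lh lp : ℕ} {v : Family (simpleClasses P p) g (lh + lp)}
  {x z : simpleClasses P p}

namespace IsArf

lemma apply_inv (hσ : IsArf σ) (x : simpleClasses P p) : σ x⁻¹ = -σ x :=
  hσ.inv x x⁻¹ rfl

lemma apply_eq_of_eq_conj [T2Space P] (hσ : IsArf σ)
    (hgen : Subgroup.closure (simpleClasses P p) = ⊤) (w : FundamentalGroup P p)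
    (h : (z : FundamentalGroup P p) = w * x * w⁻¹) : σ z = σ x := by
  have hw : w ∈ Subgroup.closure (simpleClasses P p) := hgen ▸ Subgroup.mem_top w
  induction hw using Subgroup.closure_induction generalizing x z with
  | mem w hw => exact hσ.conj x ⟨w, hw⟩ z h
  | one =>
    rw [one_mul, inv_one, mul_one] at h
    rw [Subtype.ext h]
  | mul w w' _ _ ih ih' =>
    have hx := mul_mul_inv_mem_simpleClasses ℂ x.2 w'
    rw [← ih' (z := ⟨_, hx⟩) rfl]
    refine ih ?_
    rw [h]
    group
  | inv w _ ih =>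
    refine (ih ?_).symm
    rw [h]
    group

lemma apply_add_apply_of_mul_eq_conj [T2Space P] {y : simpleClasses P p} (hσ : IsArf σ)
    (hgen : Subgroup.closure (simpleClasses P p) = ⊤)
    (hxy : IsCrossingPair (x : FundamentalGroup P p) y) (w : FundamentalGroup P p)
    (h : (x : FundamentalGroup P p) * y = w * z * w⁻¹) : σ x + σ y = σ z := by
  have hmem := mul_mul_inv_mem_simpleClasses ℂ z.2 w
  rw [← hσ.crossing x y ⟨_, hmem⟩ h.symm hxy]
  exact hσ.apply_eq_of_eq_conj hgen w rfl

lemma apply_b_mul_inv_a [T2Space P] (hσ : IsArf σ) (hv : IsStandardBasis v) {i j : Fin g}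
    (hij : i ≠ j) :
    σ ⟨_, hv.b_mul_inv_a_mem_simpleClasses hij⟩ = σ (v.b i) - σ (v.a j) - 1 := by
  rw [hσ.negative (v.b i) (v.a j)⁻¹ _ rfl (hv.isNegativePair_b_inv_a hij), hσ.apply_inv]
  ring

lemma apply_inv_c_mul_b_mul_a [T2Space P] (hσ : IsArf σ) (hv : IsStandardBasis v) (i : Fin g)
    (j : Fin (lh + lp)) : σ ⟨_, hv.inv_c_mul_b_mul_a_mem_simpleClasses i j⟩ =
      σ (v.a i) + σ (v.b i) - σ (v.c j) - 1 := by
  rw [hσ.negative (v.c j)⁻¹ ⟨_, hv.b_mul_a_mem_simpleClasses i⟩ _ rfl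
      (hv.isNegativePair_inv_c_b_mul_a i j), hσ.apply_inv,
    hσ.crossing (v.b i) (v.a i) ⟨_, hv.b_mul_a_mem_simpleClasses i⟩ rfl
      (hv.isCrossingPair_a_b i).symm]
  ring

end IsArf

end ArfFunctions

section DehnTwists

open Function

lemma comp_eq_update_of_injective {ι X Y Z : Type*} [DecidableEq ι] {f : X → Y} (hf : Injective f)
    {s : X → Z} {u u' : ι → X} {i : ι} {y : Y} {z : Z}
    (h : (fun k => f (u' k)) = update (fun k => f (u k)) i y) (hi : s (u' i) = z) :
    (fun k => s (u' k)) = update (fun k => s (u k)) i z :=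
  eq_update_iff.2 ⟨hi, fun k hk => congrArg s (hf ((eq_update_iff.1 h).2 k hk))⟩

lemma eq_update_update_iff {ι Y : Type*} [DecidableEq ι] {i j : ι} (hij : i ≠ j) {u u' : ι → Y}
    {y y' : Y} :
    u' = update (update u i y) j y' ↔ u' i = y ∧ u' j = y' ∧ ∀ k, k ≠ i → k ≠ j → u' k = u k := by
  rw [eq_update_iff]
  constructor
  · rintro ⟨hj, h⟩
    refine ⟨by rw [h i hij, update_self], hj, fun k hi hj => by rw [h k hj, update_of_ne hi]⟩
  · rintro ⟨hi, hj, h⟩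
    refine ⟨hj, fun k hkj => ?_⟩
    rcases eq_or_ne k i with rfl | hki
    · rw [hi, update_self]
    · rw [h k hki hkj, update_of_ne hki]

lemma comp_eq_update_update_of_injective {ι X Y Z : Type*} [DecidableEq ι] {f : X → Y}
    (hf : Injective f) {s : X → Z} {u u' : ι → X} {i j : ι} (hij : i ≠ j) {y y' : Y} {z z' : Z}
    (h : (fun k => f (u' k)) = update (update (fun k => f (u k)) i y) j y')
    (hi : s (u' i) = z) (hj : s (u' j) = z') :
    (fun k => s (u' k)) = update (update (fun k => s (u k)) i z) j z' :=
  (eq_update_update_iff hij).2 ⟨hi, hj, fun k hki hkj =>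
    congrArg s (hf (((eq_update_update_iff hij).1 h).2.2 k hki hkj))⟩

lemma comp_eq_comp_of_injective {ι X Y Z : Type*} {f : X → Y} (hf : Injective f) {s : X → Z}
    {u u' : ι → X} (h : (fun k => f (u' k)) = fun k => f (u k)) :
    (fun k => s (u' k)) = fun k => s (u k) :=
  funext fun k => congrArg s (hf (congrFun h k))

namespace IsArf

variable {P : Type*} [TopologicalSpace P] {p : P} [ChartedSpace ℂ P] {m : ℕ}
  {σ : simpleClasses P p → ZMod m} {g lh lp : ℕ} {v v' : Family (simpleClasses P p) g (lh + lp)}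

lemma map_eq_onValues_one (hσ : IsArf σ) (hv : IsStandardBasis v) (hg : 0 < g)
    (hD : v'.map Subtype.val = (DehnTwist.one hg).onBasis (v.map Subtype.val)) :
    v'.map σ = (DehnTwist.one hg).onValues (v.map σ) := by
  have ha := congrArg Family.a hD
  refine Family.ext (comp_eq_update_of_injective Subtype.val_injective ha ?_)
    (comp_eq_comp_of_injective Subtype.val_injective (congrArg Family.b hD))
    (comp_eq_comp_of_injective Subtype.val_injective (congrArg Family.c hD))
  exact hσ.crossing _ _ _ (eq_update_iff.1 ha).1 (hv.isCrossingPair_a_b _)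

variable [T2Space P]

lemma apply_a_add_apply_b_of_mul_eq_conj (hσ : IsArf σ) (hv : IsStandardBasis v)
    (hv' : IsStandardBasis v') {i j k : Fin g} (hij : i ≠ j) (w : FundamentalGroup P p)
    (h : (v'.a k * v'.b k : FundamentalGroup P p) =
      w * (v.b i * (v.a j : FundamentalGroup P p)⁻¹) * w⁻¹) :
    σ (v'.a k) + σ (v'.b k) = σ (v.b i) - σ (v.a j) - 1 := by
  rw [← hσ.apply_b_mul_inv_a hv hij]
  exact hσ.apply_add_apply_of_mul_eq_conj hv.closure_simpleClasses (hv'.isCrossingPair_a_b k) w h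

lemma apply_b_sub_apply_a_of_mul_inv_eq_conj (hσ : IsArf σ) (hv : IsStandardBasis v)
    (hv' : IsStandardBasis v') {i k : Fin g} {j : Fin (lh + lp)} (w : FundamentalGroup P p)
    (h : (v'.b k * (v'.a k : FundamentalGroup P p)⁻¹ : FundamentalGroup P p) =
      w * ((v.c j : FundamentalGroup P p)⁻¹ * (v.b i * v.a i)) * w⁻¹) :
    σ (v'.b k) - σ (v'.a k) = σ (v.a i) + σ (v.b i) - σ (v.c j) - 1 := by
  rw [← hσ.apply_inv_c_mul_b_mul_a hv, sub_eq_add_neg, ← hσ.apply_inv]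
  exact hσ.apply_add_apply_of_mul_eq_conj hv.closure_simpleClasses
    (hv'.isCrossingPair_a_b k).symm.inv_right w h

lemma map_eq_onValues_two (hσ : IsArf σ) (hv : IsStandardBasis v) (hv' : IsStandardBasis v')
    (hg : 1 < g) (hD : v'.map Subtype.val = (DehnTwist.two hg).onBasis (v.map Subtype.val)) :
    v'.map σ = (DehnTwist.two hg).onValues (v.map σ) := by
  have ha := congrArg Family.a hD
  have hb := congrArg Family.b hD
  set i₁ : Fin g := ⟨0, by omega⟩ with hi₁
  set i₂ : Fin g := ⟨1, hg⟩ with hi₂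
  have hne : i₁ ≠ i₂ := by simp [hi₁, hi₂]
  obtain ⟨ha₁, ha₂, -⟩ := (eq_update_update_iff hne).1 ha
  obtain ⟨hb₁, hb₂, -⟩ := (eq_update_update_iff hne).1 hb
  replace ha₁ : (v'.a i₁ : FundamentalGroup P p) =
    (v.a i₁ * v.a i₂) * v.a i₁ * (v.a i₁ * v.a i₂ : FundamentalGroup P p)⁻¹ := ha₁
  replace ha₂ : (v'.a i₂ : FundamentalGroup P p) =
    v.a i₁ * v.a i₂ * (v.a i₁ : FundamentalGroup P p)⁻¹ := ha₂
  replace hb₁ : (v'.b i₁ : FundamentalGroup P p) =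
    (v.a i₁ * v.a i₂) * (v.a i₁ : FundamentalGroup P p)⁻¹ * (v.a i₂ : FundamentalGroup P p)⁻¹ *
      v.b i₁ * (v.a i₁ * v.a i₂ : FundamentalGroup P p)⁻¹ := hb₁
  replace hb₂ : (v'.b i₂ : FundamentalGroup P p) =
    v.b i₂ * (v.a i₂ : FundamentalGroup P p)⁻¹ * (v.a i₁ : FundamentalGroup P p)⁻¹ := hb₂
  have hσa₁ : σ (v'.a i₁) = σ (v.a i₁) := hσ.apply_eq_of_eq_conj hv.closure_simpleClasses _ ha₁
  have hσa₂ : σ (v'.a i₂) = σ (v.a i₂) := hσ.apply_eq_of_eq_conj hv.closure_simpleClasses _ ha₂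
  have hσab₁ : σ (v'.a i₁) + σ (v'.b i₁) = σ (v.b i₁) - σ (v.a i₂) - 1 := by
    refine hσ.apply_a_add_apply_b_of_mul_eq_conj hv hv' hne (v.a i₁) ?_
    rw [ha₁, hb₁]
    group
  have hσab₂ : σ (v'.a i₂) + σ (v'.b i₂) = σ (v.b i₂) - σ (v.a i₁) - 1 := by
    refine hσ.apply_a_add_apply_b_of_mul_eq_conj hv hv' hne.symm (v'.a i₂) ?_
    rw [ha₂, hb₂]
    group
  have hσa := comp_eq_update_update_of_injective Subtype.val_injective hne ha hσa₁ hσa₂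
  rw [update_eq_self, update_eq_self] at hσa
  refine Family.ext hσa (comp_eq_update_update_of_injective Subtype.val_injective hne hb ?_ ?_)
    (comp_eq_comp_of_injective Subtype.val_injective (congrArg Family.c hD))
  · change σ (v'.b i₁) = σ (v.b i₁) - σ (v.a i₁) - σ (v.a i₂) - 1
    linear_combination hσab₁ - hσa₁
  · change σ (v'.b i₂) = σ (v.b i₂) - σ (v.a i₂) - σ (v.a i₁) - 1
    linear_combination hσab₂ - hσa₂

lemma map_eq_onValues_three (hσ : IsArf σ) (hv : IsStandardBasis v) (hv' : IsStandardBasis v')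
    (hg : 0 < g) (hn : 0 < lh + lp)
    (hD : v'.map Subtype.val = (DehnTwist.three hg hn).onBasis (v.map Subtype.val)) :
    v'.map σ = (DehnTwist.three hg hn).onValues (v.map σ) := by
  have ha := congrArg Family.a hD
  have hb := congrArg Family.b hD
  have hc := congrArg Family.c hD
  set i : Fin g := ⟨g - 1, by omega⟩
  set j : Fin (lh + lp) := ⟨0, hn⟩
  have ha' : (v'.a i : FundamentalGroup P p) =
      ((v.b i : FundamentalGroup P p)⁻¹ * v.c j) * (v.b i : FundamentalGroup P p)⁻¹ *
        ((v.b i : FundamentalGroup P p)⁻¹ * v.c j)⁻¹ := (eq_update_iff.1 ha).1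
  have hb' : (v'.b i : FundamentalGroup P p) =
      ((v.b i : FundamentalGroup P p)⁻¹ * v.c j * v.b i) * (v.c j : FundamentalGroup P p)⁻¹ *
        v.b i * v.a i * (v.b i : FundamentalGroup P p)⁻¹ *
        ((v.b i : FundamentalGroup P p)⁻¹ * v.c j * v.b i)⁻¹ := (eq_update_iff.1 hb).1
  have hc' : (v'.c j : FundamentalGroup P p) =
      (v.b i : FundamentalGroup P p)⁻¹ * v.c j * v.b i := (eq_update_iff.1 hc).1
  have hσa : σ (v'.a i) = -σ (v.b i) := by
    rw [← hσ.apply_inv]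
    exact hσ.apply_eq_of_eq_conj hv.closure_simpleClasses _ ha'
  have hσc : σ (v'.c j) = σ (v.c j) :=
    hσ.apply_eq_of_eq_conj hv.closure_simpleClasses (v.b i : FundamentalGroup P p)⁻¹
      (by rw [hc', inv_inv])
  have hσba : σ (v'.b i) - σ (v'.a i) = σ (v.a i) + σ (v.b i) - σ (v.c j) - 1 := by
    refine hσ.apply_b_sub_apply_a_of_mul_inv_eq_conj hv hv' (v'.c j) ?_
    rw [ha', hb', hc']
    group
  have hσc_update := comp_eq_update_of_injective Subtype.val_injective hc hσc
  rw [update_eq_self] at hσc_update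
  refine Family.ext (comp_eq_update_of_injective Subtype.val_injective ha hσa)
    (comp_eq_update_of_injective Subtype.val_injective hb ?_) hσc_update
  change σ (v'.b i) = σ (v.a i) - σ (v.c j) - 1
  linear_combination hσba + hσa

lemma map_eq_onValues_four (hσ : IsArf σ) (hv : IsStandardBasis v) {k : ℕ} (hk : k + 1 < g)
    (hD : v'.map Subtype.val = (DehnTwist.four k hk).onBasis (v.map Subtype.val)) :
    v'.map σ = (DehnTwist.four k hk).onValues (v.map σ) := by
  have ha := congrArg Family.a hD
  have hb := congrArg Family.b hD
  have hne : (⟨k, by omega⟩ : Fin g) ≠ ⟨k + 1, hk⟩ := by simp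
  obtain ⟨ha₁, ha₂, -⟩ := (eq_update_update_iff hne).1 ha
  obtain ⟨hb₁, hb₂, -⟩ := (eq_update_update_iff hne).1 hb
  exact Family.ext
    (comp_eq_update_update_of_injective Subtype.val_injective hne ha
      (congrArg σ (Subtype.ext ha₁)) (hσ.apply_eq_of_eq_conj hv.closure_simpleClasses _ ha₂))
    (comp_eq_update_update_of_injective Subtype.val_injective hne hb
      (congrArg σ (Subtype.ext hb₁)) (hσ.apply_eq_of_eq_conj hv.closure_simpleClasses _ hb₂))
    (comp_eq_comp_of_injective Subtype.val_injective (congrArg Family.c hD))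

lemma map_eq_onValues_five (hσ : IsArf σ) (hv : IsStandardBasis v) {k : ℕ} (hk : k + 1 < lh + lp)
    (hD : v'.map Subtype.val = (DehnTwist.five k hk).onBasis (v.map Subtype.val)) :
    v'.map σ = (DehnTwist.five k hk).onValues (v.map σ) := by
  have hc := congrArg Family.c hD
  have hne : (⟨k, by omega⟩ : Fin (lh + lp)) ≠ ⟨k + 1, hk⟩ := by simp
  obtain ⟨hc₁, hc₂, -⟩ := (eq_update_update_iff hne).1 hc
  have hconj : (v'.c ⟨k + 1, hk⟩ : FundamentalGroup P p) =
      (v.c ⟨k + 1, hk⟩ : FundamentalGroup P p)⁻¹ * v.c ⟨k, by omega⟩ *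
        ((v.c ⟨k + 1, hk⟩ : FundamentalGroup P p)⁻¹)⁻¹ := hc₂.trans (by rw [inv_inv]; rfl)
  exact Family.ext (comp_eq_comp_of_injective Subtype.val_injective (congrArg Family.a hD))
    (comp_eq_comp_of_injective Subtype.val_injective (congrArg Family.b hD))
    (comp_eq_update_update_of_injective Subtype.val_injective hne hc
      (congrArg σ (Subtype.ext hc₁)) (hσ.apply_eq_of_eq_conj hv.closure_simpleClasses _ hconj))

end IsArf

end DehnTwists

theorem mainTheorem10_general {P : Type*} [TopologicalSpace P] [T2Space P] [ChartedSpace ℂ P]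
    {p : P} {m g lh lp : ℕ} {σ : simpleClasses P p → ZMod m} (hσ : IsArf σ)
    {v v' : Family (simpleClasses P p) g (lh + lp)}
    (hv : IsStandardBasis v) (hv' : IsStandardBasis v') (D : DehnTwist g (lh + lp))
    (hD : v'.map Subtype.val = D.onBasis (v.map Subtype.val)) :
    v'.map σ = D.onValues (v.map σ) := by
  cases D with
  | one hg => exact hσ.map_eq_onValues_one hv hg hD
  | two hg => exact hσ.map_eq_onValues_two hv hv' hg hD
  | three hg hn => exact hσ.map_eq_onValues_three hv hv' hg hn hD
  | four k hk => exact hσ.map_eq_onValues_four hv hk hD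
  | five k hk => exact hσ.map_eq_onValues_five hv hk hD

end HigherArf

end

open HigherArf in
theorem mainTheorem10 {P : Type*} [TopologicalSpace P] [T2Space P] [ConnectedSpace P]
    [ChartedSpace ℂ P] [IsManifold 𝓘(ℂ) ω P] (hP : IsHyperbolic P) (p : P)
    (m g lh lp : ℕ) (σ : simpleClasses P p → ZMod m) (hσ : IsArf σ)
    (v v' : Family (simpleClasses P p) g (lh + lp))
    (hv : IsStandardBasis v) (hv' : IsStandardBasis v')
    (D : DehnTwist g (lh + lp))
    (hD : v'.map Subtype.val = D.onBasis (v.map Subtype.val)) :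
    v'.map σ = D.onValues (v.map σ) :=
  mainTheorem10_general hσ hv hv' D hD
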